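/- Let $n\ge 2$ and $m\ge 1$ be integers, let $a,a_1,a_2,b,c_1,\dots,c_n\in\mathbb{R}$ with $a>0$ and $\sum_{k=1}^n c_k=0$, put $\xi=\sum_{k=1}^n x_k$, and define on $\mathbb{R}^n$ $$f(x)=a_1e^{\sqrt{a/m}\,\xi}+a_2e^{-\sqrt{a/m}\,\xi},$$ $$h(x)=-\frac{(n-1)a}{2}\sum_{k=1}^n x_k^2+a\sum_{k<l}x_kx_l+\sum_{k=1}^n c_kx_k+b .$$ Assume that $f>0$ on $\mathbb{R}^n$ (equivalently, $a_1,a_2\ge 0$ and $(a_1,a_2)\ne(0,0)$). Put $\rho=-na$, and let $(F^m,g_F)$ be a smooth $m$-dimensional Riemannian Einstein manifold with $\mathrm{Ric}_{g_F}=\lambda_F\,g_F$, where $$\lambda_F=4a_1a_2\,\rho\,\frac{m-1}{m}.$$ Let $g=g_0\oplus f^2g_F$ be the warped product metric on $\mathbb{R}^n\times_f F^m$, where $g_0$ is the Euclidean metric, and regard $h$ as a function on the product that depends only on the $\mathbb{R}^n$-factor. Then $$\mathrm{Ric}_g+\mathrm{Hess}_g(h)=\rho\,g ,$$ so $(\mathbb{R}^n\times_f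 F^m,g)$ is an expanding gradient Ricci soliton ($\rho=-na<0$) with potential function $h$. If moreover $(F,g_F)$ is complete, then $(\mathbb{R}^n\times_f F^m,g)$ is complete. -/

import Mathlib

open Bundle Manifold Set Filter Topology
open scoped ContDiff ENNReal

set_option maxSynthPendingDepth 3

noncomputable section

/-! ### Levi-Civita connection, Ricci tensor and Hessian in linear coordinates

`G : V → V →L[ℝ] V →L[ℝ] ℝ` is a field of (nondegenerate, symmetric) bilinear forms on an open
subset of the finite-dimensional space `V`: a Riemannian metric read in a chart. -/

section Local

variable {V : Type*} [NormedAddCommGroup V] [NormedSpace ℝ V]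

/-- The Koszul form `(u, v, w) ↦ D_u G (v, w) + D_v G (u, w) - D_w G (u, v)` at `y`. -/
def koszulForm (G : V → V →L[ℝ] V →L[ℝ] ℝ) (y : V) : V →L[ℝ] V →L[ℝ] V →L[ℝ] ℝ :=
  fderiv ℝ G y + (fderiv ℝ G y).flip
    - ((ContinuousLinearMap.flipₗᵢ ℝ V V ℝ :
        (V →L[ℝ] V →L[ℝ] ℝ) →L[ℝ] V →L[ℝ] V →L[ℝ] ℝ) ∘L (fderiv ℝ G y).flip)

theorem koszulForm_apply (G : V → V →L[ℝ] V →L[ℝ] ℝ) (y u v w : V) :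
    koszulForm G y u v w =
      fderiv ℝ G y u v w + fderiv ℝ G y v u w - fderiv ℝ G y w u v := by
  simp [koszulForm]

/-- The Christoffel symbol `Γ_y(u, v) = ∇_u v` (for constant fields `u`, `v`) of the Levi-Civita
connection of `G`: the vector with `2 G_y (Γ_y(u, v), w) = koszulForm G y u v w` for all `w`. -/
def christoffel (G : V → V →L[ℝ] V →L[ℝ] ℝ) (y : V) : V →L[ℝ] V →L[ℝ] V :=
  (ContinuousLinearMap.compL ℝ V (V →L[ℝ] ℝ) V (G y).inverse) ∘L ((1 / 2 : ℝ) • koszulForm G y)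

theorem christoffel_spec (G : V → V →L[ℝ] V →L[ℝ] ℝ) (y u v w : V) (hG : (G y).IsInvertible) :
    G y (christoffel G y u v) w = (1 / 2) *
      (fderiv ℝ G y u v w + fderiv ℝ G y v u w - fderiv ℝ G y w u v) := by
  obtain ⟨e, he⟩ := hG
  rw [← koszulForm_apply]
  simp [christoffel, ← he]

/-- The endomorphism `u ↦ R(u, v) w = ∇_u ∇_v w - ∇_v ∇_u w` (for constant fields `u`, `v`, `w`),
where `R` is the Riemann curvature tensor of `G` at `y`. -/
def curvatureEndo (G : V → V →L[ℝ] V →L[ℝ] ℝ) (y v w : V) : V →L[ℝ] V :=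
  ((fderiv ℝ (christoffel G) y).flip v).flip w - (fderiv ℝ (christoffel G) y v).flip w
    + (christoffel G y).flip (christoffel G y v w)
    - (christoffel G y v) ∘L ((christoffel G y).flip w)

theorem curvatureEndo_apply (G : V → V →L[ℝ] V →L[ℝ] ℝ) (y u v w : V) :
    curvatureEndo G y v w u =
      fderiv ℝ (christoffel G) y u v w - fderiv ℝ (christoffel G) y v u w
        + christoffel G y u (christoffel G y v w) - christoffel G y v (christoffel G y u w) := by
  simp [curvatureEndo]

/-- The Ricci tensor of `G` at `y`: `Ric(v, w) = tr (u ↦ R(u, v) w)`. -/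
def localRicci (G : V → V →L[ℝ] V →L[ℝ] ℝ) (y v w : V) : ℝ :=
  LinearMap.trace ℝ V (curvatureEndo G y v w : V →ₗ[ℝ] V)

/-- The Hessian `(∇ dh)(v, w) = D²h(v, w) - Dh(Γ(v, w))` of `h` at `y` with respect to `G`. -/
def localHessian (G : V → V →L[ℝ] V →L[ℝ] ℝ) (h : V → ℝ) (y v w : V) : ℝ :=
  fderiv ℝ (fderiv ℝ h) y v w - fderiv ℝ h y (christoffel G y v w)

end Local

/-! ### Riemannian manifolds (without boundary) -/

section Manifold

variable {E : Type*} [NormedAddCommGroup E] [NormedSpace ℝ E]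
  {H : Type*} [TopologicalSpace H] {I : ModelWithCorners ℝ E H}
  {M : Type*} [TopologicalSpace M] [ChartedSpace H M] [IsManifold I ∞ M]

/-- The metric `g` read in the preferred chart at `p`, i.e. its pullback under the inverse of that
chart; it is meaningful on the (open) target of the chart. -/
def chartMetric (g : ContMDiffRiemannianMetric I ∞ E (fun x : M => TangentSpace I x)) (p : M)
    (y : E) : E →L[ℝ] E →L[ℝ] ℝ :=
  (ContinuousLinearMap.precomp ℝ (mfderiv 𝓘(ℝ, E) I (extChartAt I p).symm y)) ∘L
    ((g.inner ((extChartAt I p).symm y)) ∘L (mfderiv 𝓘(ℝ, E) I (extChartAt I p).symm y))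

theorem chartMetric_apply
    (g : ContMDiffRiemannianMetric I ∞ E (fun x : M => TangentSpace I x)) (p : M) (y u v : E) :
    chartMetric g p y u v = g.inner ((extChartAt I p).symm y)
      (mfderiv 𝓘(ℝ, E) I (extChartAt I p).symm y u)
      (mfderiv 𝓘(ℝ, E) I (extChartAt I p).symm y v) := rfl

/-- The Ricci tensor of `(M, g)` at `p`. -/
def ricciTensor (g : ContMDiffRiemannianMetric I ∞ E (fun x : M => TangentSpace I x)) (p : M)
    (v w : TangentSpace I p) : ℝ :=
  localRicci (chartMetric g p) (extChartAt I p p)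
    (mfderiv I 𝓘(ℝ, E) (extChartAt I p) p v) (mfderiv I 𝓘(ℝ, E) (extChartAt I p) p w)

/-- The Hessian of `h : M → ℝ` with respect to `g` at `p`. -/
def hessian (g : ContMDiffRiemannianMetric I ∞ E (fun x : M => TangentSpace I x)) (h : M → ℝ)
    (p : M) (v w : TangentSpace I p) : ℝ :=
  localHessian (chartMetric g p) (h ∘ (extChartAt I p).symm) (extChartAt I p p)
    (mfderiv I 𝓘(ℝ, E) (extChartAt I p) p v) (mfderiv I 𝓘(ℝ, E) (extChartAt I p) p w)

/-- `(M, g)` is Einstein with constant Ricci curvature `lam`: `Ric_g = lam g`. -/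
def IsEinstein (g : ContMDiffRiemannianMetric I ∞ E (fun x : M => TangentSpace I x))
    (lam : ℝ) : Prop :=
  ∀ (p : M) (v w : TangentSpace I p), ricciTensor g p v w = lam * g.inner p v w

/-- `(M, g)` is a gradient Ricci soliton with potential function `h` and constant `ρ`:
`dim M ≥ 3`, `h` is smooth and `Ric_g + Hess_g h = ρ g`. -/
structure IsGradientRicciSoliton
    (g : ContMDiffRiemannianMetric I ∞ E (fun x : M => TangentSpace I x))
    (h : M → ℝ) (ρ : ℝ) : Prop where
  three_le_dim : 3 ≤ Module.finrank ℝ E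
  smooth : ContMDiff I 𝓘(ℝ) ∞ h
  eqn : ∀ (p : M) (v w : TangentSpace I p),
    ricciTensor g p v w + hessian g h p v w = ρ * g.inner p v w

/-- An expanding gradient Ricci soliton: `ρ < 0`. -/
structure IsExpandingGradientRicciSoliton
    (g : ContMDiffRiemannianMetric I ∞ E (fun x : M => TangentSpace I x))
    (h : M → ℝ) (ρ : ℝ) : Prop extends IsGradientRicciSoliton g h ρ where
  expanding : ρ < 0

/-- The Riemannian distance of `(M, g)`: the infimum of the `g`-lengths of `C^1` paths. -/
def metricEDist (g : ContMDiffRiemannianMetric I ∞ E (fun x : M => TangentSpace I x))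
    (x y : M) : ℝ≥0∞ :=
  letI : RiemannianBundle (fun x : M => TangentSpace I x) := ⟨g.toRiemannianMetric⟩
  riemannianEDist I x y

/-- `(M, g)` is complete: every Cauchy sequence for the Riemannian distance converges. -/
def IsCompleteRiemannian
    (g : ContMDiffRiemannianMetric I ∞ E (fun x : M => TangentSpace I x)) : Prop :=
  ∀ u : ℕ → M, (∀ ε > 0, ∃ N, ∀ j ≥ N, ∀ k ≥ N, metricEDist g (u j) (u k) < ε) →
    ∃ x, Tendsto u atTop (𝓝 x)

end Manifold

/-! ### Warped products -/

section Warped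

variable {E : Type*} [NormedAddCommGroup E] [NormedSpace ℝ E]
  {H : Type*} [TopologicalSpace H] {I : ModelWithCorners ℝ E H}
  {B : Type*} [TopologicalSpace B] [ChartedSpace H B] [IsManifold I ∞ B]
  {E' : Type*} [NormedAddCommGroup E'] [NormedSpace ℝ E']
  {H' : Type*} [TopologicalSpace H'] {J : ModelWithCorners ℝ E' H'}
  {F : Type*} [TopologicalSpace F] [ChartedSpace H' F] [IsManifold J ∞ F]

/-- The bilinear form `π₁^* g_B + (f ∘ π₁)² π₂^* g_F` on the tangent space of `B × F` at `p`, where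
`π₁`, `π₂` are the projections. -/
def warpedInner (gB : ContMDiffRiemannianMetric I ∞ E (fun x : B => TangentSpace I x))
    (gF : ContMDiffRiemannianMetric J ∞ E' (fun y : F => TangentSpace J y)) (f : B → ℝ)
    (p : B × F) :
    TangentSpace (I.prod J) p →L[ℝ] TangentSpace (I.prod J) p →L[ℝ] ℝ :=
  (ContinuousLinearMap.precomp ℝ (mfderiv (I.prod J) I Prod.fst p)) ∘L
      ((gB.inner p.1) ∘L (mfderiv (I.prod J) I Prod.fst p)) +
    (f p.1) ^ 2 • ((ContinuousLinearMap.precomp ℝ (mfderiv (I.prod J) J Prod.snd p)) ∘L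
      ((gF.inner p.2) ∘L (mfderiv (I.prod J) J Prod.snd p)))

theorem warpedInner_apply (gB : ContMDiffRiemannianMetric I ∞ E (fun x : B => TangentSpace I x))
    (gF : ContMDiffRiemannianMetric J ∞ E' (fun y : F => TangentSpace J y)) (f : B → ℝ)
    (p : B × F) (v w : TangentSpace (I.prod J) p) :
    warpedInner gB gF f p v w =
      gB.inner p.1 (mfderiv (I.prod J) I Prod.fst p v) (mfderiv (I.prod J) I Prod.fst p w) +
        (f p.1) ^ 2 * gF.inner p.2 (mfderiv (I.prod J) J Prod.snd p v)
          (mfderiv (I.prod J) J Prod.snd p w) := rfl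

theorem inner_self_nonneg' (g : ContMDiffRiemannianMetric I ∞ E (fun x : B => TangentSpace I x))
    (x : B) (u : TangentSpace I x) : 0 ≤ g.inner x u u := by
  rcases eq_or_ne u 0 with rfl | hu
  · simp
  · exact (g.pos _ u hu).le

theorem mfderiv_fst_symm_trivializationAt (p₀ p : B × F)
    (h : p ∈ (chartAt (ModelProd H H') p₀).source) (v : E × E') :
    mfderiv (I.prod J) I Prod.fst p
      ((trivializationAt (E × E') (TangentSpace (I.prod J)) p₀).symm p v) =
      (trivializationAt E (TangentSpace I) p₀.1).symm p.1 v.1 := by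
  have h1 : p.1 ∈ (chartAt H p₀.1).source := by
    rw [prodChartedSpace_chartAt] at h; exact h.1
  set e := trivializationAt (E × E') (TangentSpace (I.prod J) : B × F → Type _) p₀ with he
  set e1 := trivializationAt E (TangentSpace I : B → Type _) p₀.1 with he1
  have hb : p ∈ e.baseSet := h
  have hb1 : p.1 ∈ e1.baseSet := h1
  have hcomm : (extChartAt I p₀.1 ∘ (Prod.fst : B × F → B)) =
      (Prod.fst : E × E' → E) ∘ extChartAt (I.prod J) p₀ := by
    rw [extChartAt_prod]; rfl
  have key : ∀ w : TangentSpace (I.prod J) p,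
      e1.continuousLinearMapAt ℝ p.1 (mfderiv (I.prod J) I Prod.fst p w) =
        (e.continuousLinearMapAt ℝ p w).1 := by
    intro w
    have A : mfderiv (I.prod J) 𝓘(ℝ, E) (extChartAt I p₀.1 ∘ (Prod.fst : B × F → B)) p =
        (mfderiv I 𝓘(ℝ, E) (extChartAt I p₀.1) p.1) ∘L (mfderiv (I.prod J) I Prod.fst p) :=
      mfderiv_comp p (mdifferentiableAt_extChartAt h1) mdifferentiableAt_fst
    have D : HasMFDerivAt 𝓘(ℝ, E × E') 𝓘(ℝ, E) (Prod.fst : E × E' → E)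
        (extChartAt (I.prod J) p₀ p) (ContinuousLinearMap.fst ℝ E E') :=
      (ContinuousLinearMap.fst ℝ E E').hasMFDerivAt
    have C : mfderiv (I.prod J) 𝓘(ℝ, E) (extChartAt I p₀.1 ∘ (Prod.fst : B × F → B)) p =
        (ContinuousLinearMap.fst ℝ E E') ∘L
          (mfderiv (I.prod J) 𝓘(ℝ, E × E') (extChartAt (I.prod J) p₀) p) :=
      (HasMFDerivAt.congr_of_eventuallyEq
        (D.comp p (mdifferentiableAt_extChartAt h).hasMFDerivAt)
        (Filter.Eventually.of_forall fun x => congrFun hcomm x)).mfderiv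
    have q := TangentBundle.continuousLinearMapAt_trivializationAt (I := I.prod J) h
    have q1 := TangentBundle.continuousLinearMapAt_trivializationAt (I := I) h1
    have := A.symm.trans C
    have t := congrArg (fun L : E × E' →L[ℝ] E => L w) this
    have t1 := congrArg (fun L : E →L[ℝ] E => L (mfderiv (I.prod J) I Prod.fst p w)) q1
    have t2 := congrArg (fun L : E × E' →L[ℝ] E × E' => (L w).1) q
    exact t1.trans (t.trans t2.symm)
  have k := key (e.symm p v)
  rw [← e.symmL_apply (R := ℝ) hb] at k ⊢
  rw [e.continuousLinearMapAt_symmL hb] at k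
  rw [← k, ← e1.symmL_apply (R := ℝ) hb1, e1.symmL_continuousLinearMapAt hb1]

theorem mfderiv_snd_symm_trivializationAt (p₀ p : B × F)
    (h : p ∈ (chartAt (ModelProd H H') p₀).source) (v : E × E') :
    mfderiv (I.prod J) J Prod.snd p
      ((trivializationAt (E × E') (TangentSpace (I.prod J)) p₀).symm p v) =
      (trivializationAt E' (TangentSpace J) p₀.2).symm p.2 v.2 := by
  have h1 : p.2 ∈ (chartAt H' p₀.2).source := by
    rw [prodChartedSpace_chartAt] at h; exact h.2
  set e := trivializationAt (E × E') (TangentSpace (I.prod J) : B × F → Type _) p₀ with he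
  set e1 := trivializationAt E' (TangentSpace J : F → Type _) p₀.2 with he1
  have hb : p ∈ e.baseSet := h
  have hb1 : p.2 ∈ e1.baseSet := h1
  have hcomm : (extChartAt J p₀.2 ∘ (Prod.snd : B × F → F)) =
      (Prod.snd : E × E' → E') ∘ extChartAt (I.prod J) p₀ := by
    rw [extChartAt_prod]; rfl
  have key : ∀ w : TangentSpace (I.prod J) p,
      e1.continuousLinearMapAt ℝ p.2 (mfderiv (I.prod J) J Prod.snd p w) =
        (e.continuousLinearMapAt ℝ p w).2 := by
    intro w
    have A : mfderiv (I.prod J) 𝓘(ℝ, E') (extChartAt J p₀.2 ∘ (Prod.snd : B × F → F)) p =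
        (mfderiv J 𝓘(ℝ, E') (extChartAt J p₀.2) p.2) ∘L (mfderiv (I.prod J) J Prod.snd p) :=
      mfderiv_comp p (mdifferentiableAt_extChartAt h1) mdifferentiableAt_snd
    have D : HasMFDerivAt 𝓘(ℝ, E × E') 𝓘(ℝ, E') (Prod.snd : E × E' → E')
        (extChartAt (I.prod J) p₀ p) (ContinuousLinearMap.snd ℝ E E') :=
      (ContinuousLinearMap.snd ℝ E E').hasMFDerivAt
    have C : mfderiv (I.prod J) 𝓘(ℝ, E') (extChartAt J p₀.2 ∘ (Prod.snd : B × F → F)) p =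
        (ContinuousLinearMap.snd ℝ E E') ∘L
          (mfderiv (I.prod J) 𝓘(ℝ, E × E') (extChartAt (I.prod J) p₀) p) :=
      (HasMFDerivAt.congr_of_eventuallyEq
        (D.comp p (mdifferentiableAt_extChartAt h).hasMFDerivAt)
        (Filter.Eventually.of_forall fun x => congrFun hcomm x)).mfderiv
    have q := TangentBundle.continuousLinearMapAt_trivializationAt (I := I.prod J) h
    have q1 := TangentBundle.continuousLinearMapAt_trivializationAt (I := J) h1
    have := A.symm.trans C
    have t := congrArg (fun L : E × E' →L[ℝ] E' => L w) this
    have t1 := congrArg (fun L : E' →L[ℝ] E' => L (mfderiv (I.prod J) J Prod.snd p w)) q1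
    have t2 := congrArg (fun L : E × E' →L[ℝ] E × E' => (L w).2) q
    exact t1.trans (t.trans t2.symm)
  have k := key (e.symm p v)
  rw [← e.symmL_apply (R := ℝ) hb] at k ⊢
  rw [e.continuousLinearMapAt_symmL hb] at k
  rw [← k, ← e1.symmL_apply (R := ℝ) hb1, e1.symmL_continuousLinearMapAt hb1]

theorem contMDiff_warpedInner
    (gB : ContMDiffRiemannianMetric I ∞ E (fun x : B => TangentSpace I x))
    (gF : ContMDiffRiemannianMetric J ∞ E' (fun y : F => TangentSpace J y)) (f : B → ℝ)
    (hf : ContMDiff I 𝓘(ℝ) ∞ f) :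
    ContMDiff (I.prod J) ((I.prod J).prod 𝓘(ℝ, E × E' →L[ℝ] E × E' →L[ℝ] ℝ)) ∞
      (fun p : B × F => TotalSpace.mk' (E × E' →L[ℝ] E × E' →L[ℝ] ℝ) p
        (warpedInner gB gF f p)) := by
  intro p₀
  rw [contMDiffAt_hom_bundle]
  refine ⟨contMDiffAt_id, ?_⟩
  have cB := ((contMDiffAt_hom_bundle _).1 (gB.contMDiff p₀.1)).2
  have cF := ((contMDiffAt_hom_bundle _).1 (gF.contMDiff p₀.2)).2
  have cB' := ContMDiffAt.comp p₀ cB (contMDiffAt_fst (I := I) (J := J))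
  have cF' := ContMDiffAt.comp p₀ cF (contMDiffAt_snd (I := I) (J := J))
  have cf := ContMDiffAt.comp p₀ (hf p₀.1) (contMDiffAt_fst (I := I) (J := J))
  let LB : (E →L[ℝ] E →L[ℝ] ℝ) →L[ℝ] (E × E' →L[ℝ] E × E' →L[ℝ] ℝ) :=
    (ContinuousLinearMap.precomp _ (ContinuousLinearMap.fst ℝ E E')) ∘L
      (ContinuousLinearMap.compL ℝ E (E →L[ℝ] ℝ) (E × E' →L[ℝ] ℝ)
        (ContinuousLinearMap.precomp ℝ (ContinuousLinearMap.fst ℝ E E')))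
  let LF : (E' →L[ℝ] E' →L[ℝ] ℝ) →L[ℝ] (E × E' →L[ℝ] E × E' →L[ℝ] ℝ) :=
    (ContinuousLinearMap.precomp _ (ContinuousLinearMap.snd ℝ E E')) ∘L
      (ContinuousLinearMap.compL ℝ E' (E' →L[ℝ] ℝ) (E × E' →L[ℝ] ℝ)
        (ContinuousLinearMap.precomp ℝ (ContinuousLinearMap.snd ℝ E E')))
  have c := (LB.contMDiff.contMDiffAt.comp p₀ cB').add
    ((cf.pow 2).smul (LF.contMDiff.contMDiffAt.comp p₀ cF'))
  refine c.congr_of_eventuallyEq ?_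
  filter_upwards [(chartAt (ModelProd H H') p₀).open_source.mem_nhds
    (mem_chart_source _ p₀)] with p hp
  have hp' : p.1 ∈ (chartAt H p₀.1).source ∧ p.2 ∈ (chartAt H' p₀.2).source := by
    rw [prodChartedSpace_chartAt] at hp; exact hp
  refine ContinuousLinearMap.ext fun v => ContinuousLinearMap.ext fun w => ?_
  refine (inCoordinates_apply_eq₂ (F₃ := ℝ) (E₃ := Bundle.Trivial (B × F) ℝ)
    hp hp (mem_univ _)).trans ?_
  have e1 := mfderiv_fst_symm_trivializationAt (I := I) (J := J) p₀ p hp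
  have e2 := mfderiv_snd_symm_trivializationAt (I := I) (J := J) p₀ p hp
  have i1 := inCoordinates_apply_eq₂ (F₃ := ℝ) (E₃ := Bundle.Trivial B ℝ) (ϕ := gB.inner p.1)
    (v := v.1) (w := w.1) (x₀ := p₀.1) hp'.1 hp'.1 (mem_univ _)
  have i2 := inCoordinates_apply_eq₂ (F₃ := ℝ) (E₃ := Bundle.Trivial F ℝ) (ϕ := gF.inner p.2)
    (v := v.2) (w := w.2) (x₀ := p₀.2) hp'.2 hp'.2 (mem_univ _)
  simp only [Trivial.fiberBundle_trivializationAt', Trivial.linearMapAt_trivialization,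
    LinearMap.id_coe, id_eq, warpedInner_apply] at i1 i2 ⊢
  rw [e1, e1, e2, e2]
  exact congrArg₂ (fun s t : ℝ => s + (f p.1) ^ 2 * t) i1.symm i2.symm

/-- The warped product `B ×_f F`: the metric `g_B ⊕ f² g_F` on `B × F`, with `f` positive. -/
def warpedMetric (gB : ContMDiffRiemannianMetric I ∞ E (fun x : B => TangentSpace I x))
    (gF : ContMDiffRiemannianMetric J ∞ E' (fun y : F => TangentSpace J y)) (f : B → ℝ)
    (hf : ContMDiff I 𝓘(ℝ) ∞ f) (hpos : ∀ x, 0 < f x) :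
    ContMDiffRiemannianMetric (I.prod J) ∞ (E × E')
      (fun p : B × F => TangentSpace (I.prod J) p) where
  inner p := warpedInner gB gF f p
  symm p v w := by
    rw [warpedInner_apply, warpedInner_apply, gB.symm, gF.symm]
  pos p v hv := by
    rw [warpedInner_apply, mfderiv_fst, mfderiv_snd]
    obtain ⟨v1, v2⟩ : E × E' := v
    change 0 < gB.inner p.1 v1 v1 + (f p.1) ^ 2 * gF.inner p.2 v2 v2
    have hf2 : 0 < (f p.1) ^ 2 := pow_pos (hpos _) 2
    have nB := inner_self_nonneg' gB p.1
    have nF := inner_self_nonneg' gF p.2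
    by_cases h1 : v1 = 0
    · have h2 : v2 ≠ 0 := fun h2 => hv (Prod.ext h1 h2)
      exact add_pos_of_nonneg_of_pos (nB v1) (mul_pos hf2 (gF.pos _ v2 h2))
    · exact add_pos_of_pos_of_nonneg (gB.pos _ v1 h1) (mul_nonneg hf2.le (nF v2))
  isVonNBounded p := by
    have hA : Bornology.IsVonNBounded ℝ
        {v : E | gB.inner p.1 (v : TangentSpace I p.1) (v : TangentSpace I p.1) < 1} :=
      gB.isVonNBounded p.1
    have hB : Bornology.IsVonNBounded ℝ
        {v : E' | gF.inner p.2 (v : TangentSpace J p.2) (v : TangentSpace J p.2) < 1} :=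
      gF.isVonNBounded p.2
    have hS := (hA.image (ContinuousLinearMap.inl ℝ E E')).add
      (hB.image ((f p.1)⁻¹ • ContinuousLinearMap.inr ℝ E E'))
    refine Bornology.IsVonNBounded.subset ?_ hS
    intro v hv
    have h : warpedInner gB gF f p v v < 1 := hv
    rw [warpedInner_apply, mfderiv_fst, mfderiv_snd] at h
    obtain ⟨v1, v2, hv1, hv2⟩ : ∃ (v1 : TangentSpace I p.1) (v2 : TangentSpace J p.2),
        v1 = (show E × E' from v).1 ∧ v2 = (show E × E' from v).2 := ⟨_, _, rfl, rfl⟩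
    have h' : gB.inner p.1 v1 v1 + (f p.1) ^ 2 * gF.inner p.2 v2 v2 < 1 := by
      rw [hv1, hv2]; exact h
    have hf2 : 0 < (f p.1) ^ 2 := pow_pos (hpos _) 2
    have nB := inner_self_nonneg' gB p.1 v1
    have nF := mul_nonneg hf2.le (inner_self_nonneg' gF p.2 v2)
    have sF : gF.inner p.2 (f p.1 • v2) (f p.1 • v2) < 1 := by
      rw [map_smul, map_smul, _root_.smul_apply, smul_eq_mul, smul_eq_mul]
      nlinarith
    have sB : gB.inner p.1 v1 v1 < 1 := by linarith
    refine Set.mem_add.2 ⟨(v1, 0), ⟨v1, sB, rfl⟩, (0, v2), ⟨f p.1 • v2, sF, ?_⟩, ?_⟩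
    · exact Prod.ext (smul_zero (f p.1)⁻¹) (inv_smul_smul₀ (hpos p.1).ne' v2)
    · exact Prod.ext ((add_zero v1).trans hv1) ((zero_add v2).trans hv2)
  contMDiff := contMDiff_warpedInner gB gF f hf

end Warped

/-- The canonical metric of `ℝⁿ`. -/
def euclideanMetric (n : ℕ) :
    ContMDiffRiemannianMetric 𝓘(ℝ, EuclideanSpace ℝ (Fin n)) ∞ (EuclideanSpace ℝ (Fin n))
      (fun x : EuclideanSpace ℝ (Fin n) => TangentSpace 𝓘(ℝ, EuclideanSpace ℝ (Fin n)) x) :=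
  { riemannianMetricVectorSpace (EuclideanSpace ℝ (Fin n)) with
    contMDiff := (riemannianMetricVectorSpace (EuclideanSpace ℝ (Fin n))).contMDiff.of_le le_top }

theorem euclideanMetric_inner (n : ℕ) (x v w : EuclideanSpace ℝ (Fin n)) :
    (euclideanMetric n).inner x v w = inner ℝ v w := rfl

/-- The function `f(x) = a₁ e^{√(a/m) ξ} + a₂ e^{-√(a/m) ξ}` on `ℝⁿ`, where `ξ = ∑ₖ xₖ`. -/
def expWarping (n m : ℕ) (a a₁ a₂ : ℝ) (x : EuclideanSpace ℝ (Fin n)) : ℝ :=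
  a₁ * Real.exp (√(a / m) * ∑ k, x k) + a₂ * Real.exp (-(√(a / m) * ∑ k, x k))

theorem contMDiff_expWarping (n m : ℕ) (a a₁ a₂ : ℝ) :
    ContMDiff 𝓘(ℝ, EuclideanSpace ℝ (Fin n)) 𝓘(ℝ) ∞ (expWarping n m a a₁ a₂) := by
  rw [contMDiff_iff_contDiff]
  unfold expWarping
  fun_prop

/-- The quadratic function
`h(x) = -((n-1)a/2) ∑ₖ xₖ² + a ∑_{k<l} xₖ xₗ + ∑ₖ cₖ xₖ + b` on `ℝⁿ`. -/
def quadraticPotential (n : ℕ) (a b : ℝ) (c : Fin n → ℝ) (x : EuclideanSpace ℝ (Fin n)) : ℝ :=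
  -(((n : ℝ) - 1) * a / 2) * ∑ k, x k ^ 2 + a * ∑ k, ∑ l ∈ Finset.Ioi k, x k * x l
    + ∑ k, c k * x k + b

end

/-! Write e = (1, …, 1), so that ξ = ⟨e, x⟩. For a warped product over a Euclidean base, with fibre
dimension m, Ric(v, w) = Ric_F(v₂, w₂) - (m/f) Hess f(v₁, w₁) - (f Δf + (m - 1)|∇f|²) g_F(v₂, w₂),
Hess h(v, w) = D²h(v₁, w₁) + f dh(∇f) g_F(v₂, w₂) for h on the base. These are
`localRicci_localWarped` and `localHessian_localWarped`, proved in linear coordinates from the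
Christoffel symbols and moved to the manifold by `chartMetric_warpedMetric_euclideanMetric`.

Here ∇f is a multiple of e, Hess f = (a/m) f e⊗e, and D²h = -na g₀ + a e⊗e. In base directions the
e⊗e terms cancel, which leaves -na g₀. In fibre directions dh(e) = 0, because |e|² = n and the cₖ
sum to zero, so h contributes nothing. Since |∇f|² = (na/m)(f² - 4a₁a₂), the warping terms give -na
f² plus the constant 4a₁a₂ na (m - 1)/m, which the Einstein constant of the fibre cancels.

Completeness uses only that f is continuous and positive. Projection to the base does not increase
length, so a Cauchy sequence has convergent base part. Short paths between late terms project into a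
compact ball, where f has a positive minimum, and this bounds their fibre lengths. -/

noncomputable section

/-! ### Christoffel symbols, Ricci tensor and Hessian in linear coordinates -/

section LocalGeometry

variable {V : Type*} [NormedAddCommGroup V] [NormedSpace ℝ V]

/-- Nondegeneracy makes the Koszul identity determine the vector, so a guessed Christoffel symbol
can be checked without inverting the metric. -/
theorem christoffel_eq_of_forall {G : V → V →L[ℝ] V →L[ℝ] ℝ} {y u v z : V}
    (hG : (G y).IsInvertible)
    (h : ∀ w, G y z w = (1 / 2) *
      (fderiv ℝ G y u v w + fderiv ℝ G y v u w - fderiv ℝ G y w u v)) :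
    christoffel G y u v = z := by
  refine hG.injective (ContinuousLinearMap.ext fun w => ?_)
  rw [christoffel_spec G y u v w hG, h]

theorem isInvertible_of_forall_pos [FiniteDimensional ℝ V] {B : V →L[ℝ] V →L[ℝ] ℝ}
    (hB : ∀ v, v ≠ 0 → 0 < B v v) : B.IsInvertible := by
  have hinj : Function.Injective (B : V →ₗ[ℝ] V →L[ℝ] ℝ) := by
    rw [← LinearMap.ker_eq_bot, LinearMap.ker_eq_bot']
    intro v hv
    by_contra h
    have := hB v h
    rw [show B v = 0 from hv] at this
    simp at this
  have hdim : Module.finrank ℝ V = Module.finrank ℝ (V →L[ℝ] ℝ) := by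
    rw [← (LinearMap.toContinuousLinearMap (𝕜 := ℝ) (E := V) (F' := ℝ)).finrank_eq]
    exact (Subspace.dual_finrank_eq (K := ℝ) (V := V)).symm
  refine ⟨(LinearEquiv.ofInjectiveOfFinrankEq (B : V →ₗ[ℝ] V →L[ℝ] ℝ) hinj
    hdim).toContinuousLinearEquiv, ?_⟩
  ext v w
  rfl

/-- Inversion of operators is smooth, and the symbol is the inverse metric applied to first
derivatives of the metric. Curvature differentiates the symbol, and `fderiv` is meaningful only once
this is known. -/
theorem differentiableAt_christoffel [CompleteSpace V] {G : V → V →L[ℝ] V →L[ℝ] ℝ} {y : V}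
    (hG : ContDiffAt ℝ ∞ G y) (hi : (G y).IsInvertible) :
    DifferentiableAt ℝ (christoffel G) y := by
  have h1 : DifferentiableAt ℝ (fun z => (G z).inverse) y :=
    ((hi.contDiffAt_map_inverse (n := 1)).comp y (hG.of_le (by simp))).differentiableAt (by simp)
  have h2 : DifferentiableAt ℝ (fderiv ℝ G) y :=
    (hG.fderiv_right (m := 1) (by norm_cast)).differentiableAt (by simp)
  have h3 : DifferentiableAt ℝ (koszulForm G) y := by
    unfold koszulForm
    have hflip : DifferentiableAt ℝ (fun z => (fderiv ℝ G z).flip) y :=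
      (ContinuousLinearMap.flipₗᵢ ℝ V V
        (V →L[ℝ] ℝ)).toContinuousLinearEquiv.toContinuousLinearMap.differentiableAt.comp y h2
    exact (h2.add hflip).sub ((differentiableAt_const _).clm_comp hflip)
  unfold christoffel
  exact (((ContinuousLinearMap.compL ℝ V (V →L[ℝ] ℝ) V).differentiableAt).comp y h1).clm_comp
    (h3.const_smul (1 / 2 : ℝ))

/-- Torsion-freeness: symmetry of the metric near the point passes to its derivative, and the Koszul
form is then symmetric in its first two slots. -/
theorem christoffel_comm {G : V → V →L[ℝ] V →L[ℝ] ℝ} {y : V} (hG : (G y).IsInvertible)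
    (hd : DifferentiableAt ℝ G y) (hs : ∀ᶠ z in 𝓝 y, ∀ u v, G z u v = G z v u) (u v : V) :
    christoffel G y u v = christoffel G y v u := by
  refine christoffel_eq_of_forall hG fun w => ?_
  have key : ∀ x, fderiv ℝ G y x u v = fderiv ℝ G y x v u := by
    intro x
    have e : ∀ a b : V, fderiv ℝ G y x a b = fderiv ℝ (fun z => G z a b) y x := by
      intro a b
      rw [((hd.hasFDerivAt.clm_apply (hasFDerivAt_const a y)).clm_apply
        (hasFDerivAt_const b y)).fderiv]
      simp
    rw [e, e]
    have : (fun z => G z u v) =ᶠ[𝓝 y] fun z => G z v u := hs.mono fun z hz => hz u v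
    rw [this.fderiv_eq]
  rw [christoffel_spec G y v u w hG, key w]
  ring

theorem christoffel_congr {G G' : V → V →L[ℝ] V →L[ℝ] ℝ} {y : V} (h : G =ᶠ[𝓝 y] G') :
    christoffel G y = christoffel G' y := by
  rw [christoffel, christoffel, koszulForm, koszulForm, h.fderiv_eq, h.eq_of_nhds]

theorem christoffel_eventuallyEq {G G' : V → V →L[ℝ] V →L[ℝ] ℝ} {y : V} (h : G =ᶠ[𝓝 y] G') :
    christoffel G =ᶠ[𝓝 y] christoffel G' :=
  h.eventuallyEq_nhds.mono fun _ hz => christoffel_congr hz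

/-- Only the germ of the metric matters, so a chart expression may be replaced by an explicit
formula valid near the point. -/
theorem localRicci_congr {G G' : V → V →L[ℝ] V →L[ℝ] ℝ} {y : V} (h : G =ᶠ[𝓝 y] G') (v w : V) :
    localRicci G y v w = localRicci G' y v w := by
  rw [localRicci, localRicci, curvatureEndo, curvatureEndo,
    (christoffel_eventuallyEq h).fderiv_eq, christoffel_congr h]

theorem localHessian_congr {G G' : V → V →L[ℝ] V →L[ℝ] ℝ} {y : V} (h : G =ᶠ[𝓝 y] G')
    (φ : V → ℝ) (v w : V) : localHessian G φ y v w = localHessian G' φ y v w := by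
  rw [localHessian, localHessian, christoffel_congr h]

end LocalGeometry

/-! ### Traces on a product space -/

section TraceProd

variable {R M N : Type*} [Field R] [AddCommGroup M] [AddCommGroup N] [Module R M] [Module R N]
  [FiniteDimensional R M] [FiniteDimensional R N]

/-- The trace of an endomorphism of a product is the sum of the traces of its diagonal blocks. -/
theorem LinearMap.trace_prod_eq_add (L : M × N →ₗ[R] M × N) :
    LinearMap.trace R (M × N) L =
      LinearMap.trace R M (LinearMap.fst R M N ∘ₗ L ∘ₗ LinearMap.inl R M N) +
        LinearMap.trace R N (LinearMap.snd R M N ∘ₗ L ∘ₗ LinearMap.inr R M N) := by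
  have hL : L = (L ∘ₗ LinearMap.inl R M N) ∘ₗ LinearMap.fst R M N +
      (L ∘ₗ LinearMap.inr R M N) ∘ₗ LinearMap.snd R M N := by
    refine LinearMap.ext fun x => ?_
    simp [← map_add]
  conv_lhs => rw [hL]
  -- Cyclicity of the trace moves each projection to the left of `L`, leaving the diagonal blocks.
  rw [map_add, LinearMap.trace_comp_comm', LinearMap.trace_comp_comm' _ (LinearMap.snd R M N)]

end TraceProd

/-! ### The warped metric in coordinates and its Christoffel symbols -/

section LocalWarped

variable {E : Type*} [NormedAddCommGroup E] [InnerProductSpace ℝ E]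
  {E' : Type*} [NormedAddCommGroup E'] [NormedSpace ℝ E']

/-- The warped product metric `⟪·, ·⟫ ⊕ f² K` on `E × E'`, in linear coordinates. -/
def localWarped (f : E → ℝ) (K : E' → E' →L[ℝ] E' →L[ℝ] ℝ) (y : E × E') :
    E × E' →L[ℝ] E × E' →L[ℝ] ℝ :=
  ((ContinuousLinearMap.precomp ℝ (ContinuousLinearMap.fst ℝ E E')) ∘L
      ((innerSL ℝ) ∘L (ContinuousLinearMap.fst ℝ E E'))) +
    (f y.1) ^ 2 • ((ContinuousLinearMap.precomp ℝ (ContinuousLinearMap.snd ℝ E E')) ∘L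
      ((K y.2) ∘L (ContinuousLinearMap.snd ℝ E E')))

theorem localWarped_apply (f : E → ℝ) (K : E' → E' →L[ℝ] E' →L[ℝ] ℝ) (y u v : E × E') :
    localWarped f K y u v = inner ℝ u.1 v.1 + (f y.1) ^ 2 * K y.2 u.2 v.2 := by
  simp [localWarped]
  rfl

theorem localWarped_pos {f : E → ℝ} {K : E' → E' →L[ℝ] E' →L[ℝ] ℝ} {y : E × E'}
    (hf : f y.1 ≠ 0) (hK : ∀ u, u ≠ 0 → 0 < K y.2 u u) (v : E × E') (hv : v ≠ 0) :
    0 < localWarped f K y v v := by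
  rw [localWarped_apply, real_inner_self_eq_norm_sq]
  have hf2 : 0 < f y.1 ^ 2 := by positivity
  by_cases h2 : v.2 = 0
  · have h1 : v.1 ≠ 0 := fun h1 => hv (Prod.ext h1 h2)
    rw [h2, map_zero, mul_zero, add_zero]
    positivity
  · have := hK _ h2
    positivity

theorem contDiffAt_localWarped {f : E → ℝ} {K : E' → E' →L[ℝ] E' →L[ℝ] ℝ} {y : E × E'}
    (hf : ContDiff ℝ ∞ f) (hK : ContDiffAt ℝ ∞ K y.2) :
    ContDiffAt ℝ ∞ (localWarped f K) y := by
  have hK' : ContDiffAt ℝ ∞ (fun z : E × E' => K z.2) y := hK.comp y contDiffAt_snd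
  have hf' : ContDiffAt ℝ ∞ (fun z : E × E' => f z.1) y := (hf.comp contDiff_fst).contDiffAt
  unfold localWarped
  exact contDiffAt_const.add ((hf'.pow 2).smul
    (contDiffAt_const.clm_comp (hK'.clm_comp contDiffAt_const)))

theorem fderiv_localWarped {f : E → ℝ} {N : E} {K : E' → E' →L[ℝ] E' →L[ℝ] ℝ} {y : E × E'}
    (hf : HasFDerivAt f (innerSL ℝ N) y.1) (hK : DifferentiableAt ℝ K y.2) (u v w : E × E') :
    fderiv ℝ (localWarped f K) y u v w =
      2 * f y.1 * inner ℝ N u.1 * K y.2 v.2 w.2 + f y.1 ^ 2 * fderiv ℝ K y.2 u.2 v.2 w.2 := by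
  have hK' : HasFDerivAt (fun z : E × E' => K z.2)
      ((fderiv ℝ K y.2) ∘L (ContinuousLinearMap.snd ℝ E E')) y :=
    hK.hasFDerivAt.comp y hasFDerivAt_snd
  have hf' : HasFDerivAt (fun z : E × E' => f z.1)
      ((innerSL ℝ N) ∘L (ContinuousLinearMap.fst ℝ E E')) y := hf.comp y hasFDerivAt_fst
  have hd : DifferentiableAt ℝ (localWarped f K) y := by
    unfold localWarped
    exact (differentiableAt_const _).add ((hf'.differentiableAt.pow 2).smul
      ((differentiableAt_const _).clm_comp
        (hK'.differentiableAt.clm_comp (differentiableAt_const _))))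
  -- Evaluation at fixed vectors commutes with differentiation, so the product rule is needed only
  -- for a scalar function.
  have e : fderiv ℝ (localWarped f K) y u v w = fderiv ℝ (fun z => localWarped f K z v w) y u := by
    rw [((hd.hasFDerivAt.clm_apply (hasFDerivAt_const v y)).clm_apply
      (hasFDerivAt_const w y)).fderiv]
    simp
  rw [e]
  simp only [localWarped_apply]
  have := ((hasFDerivAt_const (inner ℝ v.1 w.1) y).add ((hf'.pow 2).mul
    ((hK'.clm_apply (hasFDerivAt_const v.2 y)).clm_apply (hasFDerivAt_const w.2 y)))).fderiv
  refine (congrArg (fun L : E × E' →L[ℝ] ℝ => L u) this).trans ?_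
  simp
  ring

/-- The right-hand side is found by solving the Koszul identity separately for test vectors in the
base and in the fibre; `N` is the gradient of `f`. -/
theorem christoffel_localWarped [FiniteDimensional ℝ E] [FiniteDimensional ℝ E']
    {f : E → ℝ} {N : E} {K : E' → E' →L[ℝ] E' →L[ℝ] ℝ}
    {y : E × E'} (hf : HasFDerivAt f (innerSL ℝ N) y.1) (hf0 : f y.1 ≠ 0)
    (hK : DifferentiableAt ℝ K y.2) (hKpos : ∀ u, u ≠ 0 → 0 < K y.2 u u) (u v : E × E') :
    christoffel (localWarped f K) y u v =
      (-(f y.1 * K y.2 u.2 v.2) • N,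
        christoffel K y.2 u.2 v.2 + (inner ℝ N u.1 / f y.1) • v.2 +
          (inner ℝ N v.1 / f y.1) • u.2) := by
  refine christoffel_eq_of_forall (isInvertible_of_forall_pos (localWarped_pos hf0 hKpos))
    fun w => ?_
  have hs := christoffel_spec K y.2 u.2 v.2 w.2 (isInvertible_of_forall_pos hKpos)
  rw [localWarped_apply, fderiv_localWarped hf hK, fderiv_localWarped hf hK,
    fderiv_localWarped hf hK]
  simp only [map_add, map_smul, add_apply, smul_apply, hs, smul_eq_mul, inner_smul_left,
    RCLike.conj_to_real]
  field_simp
  ring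

end LocalWarped

/-! ### Curvature and Hessian of the warped metric -/

section LocalWarpedCurvature

variable {E : Type*} [NormedAddCommGroup E] [InnerProductSpace ℝ E] [FiniteDimensional ℝ E]
  {E' : Type*} [NormedAddCommGroup E'] [NormedSpace ℝ E'] [FiniteDimensional ℝ E']
  {f : E → ℝ} {N : E → E} {N' : E →L[ℝ] E} {K : E' → E' →L[ℝ] E' →L[ℝ] ℝ} {y : E × E'}

/-- Differentiates the explicit Christoffel symbols, which must therefore be known on a
neighbourhood; `N'` is the Hessian of `f` as an endomorphism. -/
theorem fderiv_christoffel_localWarped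
    (hf : ContDiff ℝ ∞ f) (hf0 : ∀ x, f x ≠ 0) (hN : ∀ x, HasFDerivAt f (innerSL ℝ (N x)) x)
    (hN' : HasFDerivAt N N' y.1) (hK : ContDiffAt ℝ ∞ K y.2)
    (hKpos : ∀ᶠ z in 𝓝 y.2, ∀ u, u ≠ 0 → 0 < K z u u) (u v w : E × E') :
    fderiv ℝ (christoffel (localWarped f K)) y u v w =
      (-(inner ℝ (N y.1) u.1 * K y.2 v.2 w.2 + f y.1 * fderiv ℝ K y.2 u.2 v.2 w.2) • N y.1
          - (f y.1 * K y.2 v.2 w.2) • N' u.1,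
        fderiv ℝ (christoffel K) y.2 u.2 v.2 w.2 +
          (inner ℝ (N' u.1) v.1 / f y.1
            - inner ℝ (N y.1) u.1 * inner ℝ (N y.1) v.1 / f y.1 ^ 2) • w.2 +
          (inner ℝ (N' u.1) w.1 / f y.1
            - inner ℝ (N y.1) u.1 * inner ℝ (N y.1) w.1 / f y.1 ^ 2) • v.2) := by
  have hKd : ∀ᶠ z in 𝓝 y.2, DifferentiableAt ℝ K z :=
    -- Smoothness at a point spreads to a neighbourhood only for an order other than `∞`, so the
    -- order is first lowered to 1.
    ((hK.of_le (m := 1) (by simp)).eventually (by simp)).mono fun z hz =>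
      hz.differentiableAt (by simp)
  have hd : DifferentiableAt ℝ (christoffel (localWarped f K)) y :=
    differentiableAt_christoffel (contDiffAt_localWarped hf hK)
      (isInvertible_of_forall_pos (localWarped_pos (hf0 _) hKpos.self_of_nhds))
  have hdK : DifferentiableAt ℝ (christoffel K) y.2 :=
    differentiableAt_christoffel hK (isInvertible_of_forall_pos hKpos.self_of_nhds)
  have e : fderiv ℝ (christoffel (localWarped f K)) y u v w =
      fderiv ℝ (fun z => christoffel (localWarped f K) z v w) y u := by
    rw [((hd.hasFDerivAt.clm_apply (hasFDerivAt_const v y)).clm_apply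
      (hasFDerivAt_const w y)).fderiv]
    simp
  have hev : (fun z => christoffel (localWarped f K) z v w) =ᶠ[𝓝 y] fun z : E × E' =>
      (-(f z.1 * K z.2 v.2 w.2) • N z.1,
        christoffel K z.2 v.2 w.2 + (inner ℝ (N z.1) v.1 * (f z.1)⁻¹) • w.2 +
          (inner ℝ (N z.1) w.1 * (f z.1)⁻¹) • v.2) := by
    have h2 : Tendsto (Prod.snd : E × E' → E') (𝓝 y) (𝓝 y.2) := continuousAt_snd
    filter_upwards [h2.eventually hKd, h2.eventually hKpos] with z hz hz'
    rw [christoffel_localWarped (hN z.1) (hf0 _) hz hz', div_eq_mul_inv, div_eq_mul_inv]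
  rw [e, hev.fderiv_eq]
  have dK : HasFDerivAt (fun z : E × E' => K z.2 v.2 w.2) _ y :=
    (((hKd.self_of_nhds.hasFDerivAt.comp y hasFDerivAt_snd).clm_apply
      (hasFDerivAt_const v.2 y)).clm_apply (hasFDerivAt_const w.2 y))
  have dΓ : HasFDerivAt (fun z : E × E' => christoffel K z.2 v.2 w.2) _ y :=
    (((hdK.hasFDerivAt.comp y hasFDerivAt_snd).clm_apply
      (hasFDerivAt_const v.2 y)).clm_apply (hasFDerivAt_const w.2 y))
  have df : HasFDerivAt (fun z : E × E' => f z.1) _ y := (hN y.1).comp y hasFDerivAt_fst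
  have dN : HasFDerivAt (fun z : E × E' => N z.1) _ y := hN'.comp y hasFDerivAt_fst
  have di : HasFDerivAt (fun z : E × E' => (f z.1)⁻¹) _ y :=
    (hasDerivAt_inv (hf0 y.1)).comp_hasFDerivAt y df
  have dNv := dN.inner ℝ (hasFDerivAt_const v.1 y)
  have dNw := dN.inner ℝ (hasFDerivAt_const w.1 y)
  have D := ((df.mul dK).neg.smul dN).prodMk
    ((dΓ.add ((dNv.mul di).smul (hasFDerivAt_const w.2 y))).add
      ((dNw.mul di).smul (hasFDerivAt_const v.2 y)))
  refine (congrArg (fun L : E × E' →L[ℝ] E × E' => L u) D.fderiv).trans ?_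
  refine Prod.ext ?_ ?_
  · simp [innerSL_apply_apply]
    module
  · simp [innerSL_apply_apply]
    module

/-- The block of the curvature endomorphism of a warped product along the base. -/
theorem curvatureEndo_localWarped_inl
    (hf : ContDiff ℝ ∞ f) (hf0 : ∀ x, f x ≠ 0) (hN : ∀ x, HasFDerivAt f (innerSL ℝ (N x)) x)
    (hN' : HasFDerivAt N N' y.1) (hK : ContDiffAt ℝ ∞ K y.2)
    (hKpos : ∀ᶠ z in 𝓝 y.2, ∀ u, u ≠ 0 → 0 < K z u u) (v w : E × E') (u : E) :
    (curvatureEndo (localWarped f K) y v w (u, 0)).1 = -(f y.1 * K y.2 v.2 w.2) • N' u := by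
  have hKd : DifferentiableAt ℝ K y.2 := hK.differentiableAt (by simp)
  rw [curvatureEndo_apply]
  simp only [fderiv_christoffel_localWarped hf hf0 hN hN' hK hKpos,
    christoffel_localWarped (hN y.1) (hf0 _) hKd hKpos.self_of_nhds]
  have := hf0 y.1
  simp
  match_scalars <;> field_simp
  ring

/-- The block of the curvature endomorphism of a warped product along the fibre. -/
theorem curvatureEndo_localWarped_inr
    (hf : ContDiff ℝ ∞ f) (hf0 : ∀ x, f x ≠ 0) (hN : ∀ x, HasFDerivAt f (innerSL ℝ (N x)) x)
    (hN' : HasFDerivAt N N' y.1) (hK : ContDiffAt ℝ ∞ K y.2)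
    (hKpos : ∀ᶠ z in 𝓝 y.2, ∀ u, u ≠ 0 → 0 < K z u u)
    (hKsymm : ∀ᶠ z in 𝓝 y.2, ∀ u v, K z u v = K z v u) (v w : E × E') (u : E') :
    (curvatureEndo (localWarped f K) y v w (0, u)).2 =
      curvatureEndo K y.2 v.2 w.2 u
        - (inner ℝ (N' v.1) w.1 / f y.1 + ‖N y.1‖ ^ 2 * K y.2 v.2 w.2) • u
        + (‖N y.1‖ ^ 2 * K y.2 w.2 u) • v.2 := by
  have hKd : DifferentiableAt ℝ K y.2 := hK.differentiableAt (by simp)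
  -- The double Christoffel terms contain the fibre symbol with `u` and `v.2` in both orders; they
  -- cancel by symmetry.
  have hc := christoffel_comm (isInvertible_of_forall_pos hKpos.self_of_nhds) hKd hKsymm u v.2
  rw [curvatureEndo_apply, curvatureEndo_apply, hKsymm.self_of_nhds w.2 u]
  simp only [fderiv_christoffel_localWarped hf hf0 hN hN' hK hKpos,
    christoffel_localWarped (hN y.1) (hf0 _) hKd hKpos.self_of_nhds]
  have := hf0 y.1
  simp [hc, inner_smul_right]
  match_scalars <;> field_simp <;> ring

/-- The Ricci tensor of a warped product over a Euclidean base. -/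
theorem localRicci_localWarped
    (hf : ContDiff ℝ ∞ f) (hf0 : ∀ x, f x ≠ 0) (hN : ∀ x, HasFDerivAt f (innerSL ℝ (N x)) x)
    (hN' : HasFDerivAt N N' y.1) (hK : ContDiffAt ℝ ∞ K y.2)
    (hKpos : ∀ᶠ z in 𝓝 y.2, ∀ u, u ≠ 0 → 0 < K z u u)
    (hKsymm : ∀ᶠ z in 𝓝 y.2, ∀ u v, K z u v = K z v u) (v w : E × E') :
    localRicci (localWarped f K) y v w =
      localRicci K y.2 v.2 w.2 - Module.finrank ℝ E' / f y.1 * inner ℝ (N' v.1) w.1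
        - (f y.1 * LinearMap.trace ℝ E (N' : E →ₗ[ℝ] E)
          + (Module.finrank ℝ E' - 1) * ‖N y.1‖ ^ 2) * K y.2 v.2 w.2 := by
  rw [localRicci, LinearMap.trace_prod_eq_add]
  have h1 : LinearMap.fst ℝ E E' ∘ₗ (curvatureEndo (localWarped f K) y v w : E × E' →ₗ[ℝ] E × E')
      ∘ₗ LinearMap.inl ℝ E E' = -(f y.1 * K y.2 v.2 w.2) • (N' : E →ₗ[ℝ] E) :=
    LinearMap.ext fun u => curvatureEndo_localWarped_inl hf hf0 hN hN' hK hKpos v w u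
  -- The multiple of the identity contributes m copies of |∇f|² K to the trace, and the rank-one
  -- term gives one copy back: hence the factor m - 1.
  have h2 : LinearMap.snd ℝ E E' ∘ₗ (curvatureEndo (localWarped f K) y v w : E × E' →ₗ[ℝ] E × E')
      ∘ₗ LinearMap.inr ℝ E E' = (curvatureEndo K y.2 v.2 w.2 : E' →ₗ[ℝ] E')
        - (inner ℝ (N' v.1) w.1 / f y.1 + ‖N y.1‖ ^ 2 * K y.2 v.2 w.2) • LinearMap.id
        + ‖N y.1‖ ^ 2 • (K y.2 w.2 : E' →ₗ[ℝ] ℝ).smulRight v.2 := by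
    refine LinearMap.ext fun u =>
      (curvatureEndo_localWarped_inr hf hf0 hN hN' hK hKpos hKsymm v w u).trans ?_
    simp [smul_smul]
  rw [h1, h2]
  simp only [map_add, map_sub, map_smul, LinearMap.trace_id, LinearMap.trace_smulRight,
    smul_eq_mul]
  rw [localRicci, ContinuousLinearMap.coe_coe, hKsymm.self_of_nhds w.2 v.2]
  ring

/-- The Hessian, in a warped product over a Euclidean base, of a function on the base. -/
theorem localHessian_localWarped {h : E → ℝ} (hh : ContDiff ℝ ∞ h)
    (hf0 : f y.1 ≠ 0) (hN : HasFDerivAt f (innerSL ℝ (N y.1)) y.1)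
    (hK : DifferentiableAt ℝ K y.2) (hKpos : ∀ u, u ≠ 0 → 0 < K y.2 u u) (v w : E × E') :
    localHessian (localWarped f K) (fun z => h z.1) y v w =
      fderiv ℝ (fderiv ℝ h) y.1 v.1 w.1 + f y.1 * K y.2 v.2 w.2 * fderiv ℝ h y.1 (N y.1) := by
  have hd : ∀ z, HasFDerivAt h (fderiv ℝ h z) z := fun z =>
    (hh.differentiable (by simp)).differentiableAt.hasFDerivAt
  have e : fderiv ℝ (fun z : E × E' => h z.1) =
      fun z => (fderiv ℝ h z.1) ∘L (ContinuousLinearMap.fst ℝ E E') :=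
    funext fun z => ((hd z.1).comp z hasFDerivAt_fst).fderiv
  have hd2 : HasFDerivAt (fderiv ℝ h) (fderiv ℝ (fderiv ℝ h) y.1) y.1 :=
    ((hh.fderiv_right (m := 1) (by norm_cast)).differentiable
      (by simp)).differentiableAt.hasFDerivAt
  have e2 : fderiv ℝ (fun z : E × E' => (fderiv ℝ h z.1) ∘L (ContinuousLinearMap.fst ℝ E E')) y v w
      = fderiv ℝ (fderiv ℝ h) y.1 v.1 w.1 := by
    have d := ((hd2.comp y hasFDerivAt_fst).clm_comp
      (hasFDerivAt_const (ContinuousLinearMap.fst ℝ E E') y)).fderiv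
    refine (congrArg (fun L : E × E' →L[ℝ] E × E' →L[ℝ] ℝ => L v w) d).trans ?_
    simp
  rw [localHessian, e, christoffel_localWarped hN hf0 hK hKpos, e2]
  simp

end LocalWarpedCurvature

/-! ### A Riemannian metric read in a chart -/

section ChartMetric

variable {E : Type*} [NormedAddCommGroup E] [NormedSpace ℝ E]
  {H : Type*} [TopologicalSpace H] {I : ModelWithCorners ℝ E H}
  {M : Type*} [TopologicalSpace M] [ChartedSpace H M] [IsManifold I ∞ M]
  (g : ContMDiffRiemannianMetric I ∞ E (fun x : M => TangentSpace I x))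

theorem chartMetric_symm (p : M) (y u v : E) : chartMetric g p y u v = chartMetric g p y v u := by
  rw [chartMetric_apply, chartMetric_apply, g.symm]

variable [I.Boundaryless]

theorem mfderiv_extChartAt_symm_isInvertible {p : M} {y : E} (hy : y ∈ (extChartAt I p).target) :
    (mfderiv 𝓘(ℝ, E) I (extChartAt I p).symm y).IsInvertible := by
  have := isInvertible_mfderivWithin_extChartAt_symm (I := I) hy
  rwa [I.range_eq_univ, mfderivWithin_univ] at this

theorem chartMetric_pos {p : M} {y : E} (hy : y ∈ (extChartAt I p).target) (u : E) (hu : u ≠ 0) :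
    0 < chartMetric g p y u u := by
  rw [chartMetric_apply]
  refine g.pos _ _ fun h => hu ?_
  exact (mfderiv_extChartAt_symm_isInvertible hy).injective (h.trans (map_zero _).symm)

/-- The tangent space at `p` is identified with `E` through the preferred chart at `p`, so the
inverse chart has identity derivative at the centre. -/
theorem chartMetric_extChartAt_self (p : M) (v w : E) :
    chartMetric g p (extChartAt I p p) v w = g.inner p v w := by
  -- The point occurs in the type of the tangent vectors, so the equality of points is used by
  -- substitution on a generic `x`.
  have key : ∀ x : M, x = p → ∀ v w : E, g.inner x v w = g.inner p v w := by
    rintro x rfl v w; rfl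
  have h := mfderivWithin_range_extChartAt_symm (I := I) (x := p)
  rw [I.range_eq_univ, mfderivWithin_univ] at h
  refine (chartMetric_apply g p _ v w).trans ?_
  rw [h]
  exact key _ (extChartAt_to_inv p) v w

/-- Near the centre, the inverse of the tangent trivialization at `p` is the derivative of the
inverse chart. The chart metric is thus the trivialized section `g`, which is smooth, composed with
the inverse chart. -/
theorem contDiffAt_chartMetric (p : M) :
    ContDiffAt ℝ ∞ (chartMetric g p) (extChartAt I p p) := by
  have hc := ((contMDiffAt_hom_bundle _).1 (g.contMDiff p)).2
  have hs : ContMDiffAt 𝓘(ℝ, E) I ∞ (extChartAt I p).symm (extChartAt I p p) :=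
    (contMDiffOn_extChartAt_symm p).contMDiffAt
      ((isOpen_extChartAt_target p).mem_nhds (mem_extChartAt_target p))
  rw [← contMDiffAt_iff_contDiffAt]
  refine (ContMDiffAt.comp_of_eq hc hs (extChartAt_to_inv p)).congr_of_eventuallyEq ?_
  filter_upwards [(isOpen_extChartAt_target p).mem_nhds (mem_extChartAt_target (I := I) p)]
    with y hy
  have hy' : (extChartAt I p).symm y ∈ (chartAt H p).source := by
    have := (extChartAt I p).map_target hy
    rwa [extChartAt_source] at this
  refine ContinuousLinearMap.ext fun v => ContinuousLinearMap.ext fun w => ?_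
  have i1 := inCoordinates_apply_eq₂ (F₃ := ℝ) (E₃ := Bundle.Trivial M ℝ)
    (ϕ := g.inner ((extChartAt I p).symm y)) (v := v) (w := w) (x₀ := p) hy' hy' (mem_univ _)
  have hD := TangentBundle.symmL_trivializationAt (I := I) hy'
  rw [I.range_eq_univ, mfderivWithin_univ, (extChartAt I p).right_inv hy] at hD
  have hD' : ∀ u : E, (trivializationAt E (TangentSpace I) p).symm ((extChartAt I p).symm y) u =
      mfderiv 𝓘(ℝ, E) I (extChartAt I p).symm y u := by
    intro u
    rw [← hD]
    exact ((trivializationAt E (TangentSpace I : M → Type _) p).symmL_apply (R := ℝ) hy' u).symm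
  simp only [Trivial.fiberBundle_trivializationAt', Trivial.linearMapAt_trivialization,
    LinearMap.id_coe, id_eq] at i1
  rw [hD', hD'] at i1
  exact i1.symm

end ChartMetric

/-! ### Warped products in product charts -/

section WarpedChart

variable {E : Type*} [NormedAddCommGroup E] [NormedSpace ℝ E]
  {H : Type*} [TopologicalSpace H] {I : ModelWithCorners ℝ E H} [I.Boundaryless]
  {B : Type*} [TopologicalSpace B] [ChartedSpace H B] [IsManifold I ∞ B]
  {E' : Type*} [NormedAddCommGroup E'] [NormedSpace ℝ E']
  {H' : Type*} [TopologicalSpace H'] {J : ModelWithCorners ℝ E' H'} [J.Boundaryless]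
  {F : Type*} [TopologicalSpace F] [ChartedSpace H' F] [IsManifold J ∞ F]

/-- Product charts commute with both projections, so by the chain rule the pullback splits into the
pullbacks on the factors. -/
theorem chartMetric_warpedMetric
    (gB : ContMDiffRiemannianMetric I ∞ E (fun x : B => TangentSpace I x))
    (gF : ContMDiffRiemannianMetric J ∞ E' (fun y : F => TangentSpace J y)) (f : B → ℝ)
    (hf : ContMDiff I 𝓘(ℝ) ∞ f) (hpos : ∀ x, 0 < f x) (p : B × F) {y : E × E'}
    (hy : y ∈ (extChartAt (I.prod J) p).target) (u v : E × E') :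
    chartMetric (warpedMetric gB gF f hf hpos) p y u v =
      chartMetric gB p.1 y.1 u.1 v.1 +
        f ((extChartAt I p.1).symm y.1) ^ 2 * chartMetric gF p.2 y.2 u.2 v.2 := by
  have hy' : y.1 ∈ (extChartAt I p.1).target ∧ y.2 ∈ (extChartAt J p.2).target := by
    rw [extChartAt_prod] at hy; exact hy
  have hd : MDifferentiableAt 𝓘(ℝ, E × E') (I.prod J) (extChartAt (I.prod J) p).symm y :=
    (mdifferentiableOn_extChartAt_symm).mdifferentiableAt
      ((isOpen_extChartAt_target p).mem_nhds hy)
  have hd1 : MDifferentiableAt 𝓘(ℝ, E) I (extChartAt I p.1).symm y.1 :=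
    (mdifferentiableOn_extChartAt_symm).mdifferentiableAt
      ((isOpen_extChartAt_target p.1).mem_nhds hy'.1)
  have hd2 : MDifferentiableAt 𝓘(ℝ, E') J (extChartAt J p.2).symm y.2 :=
    (mdifferentiableOn_extChartAt_symm).mdifferentiableAt
      ((isOpen_extChartAt_target p.2).mem_nhds hy'.2)
  have c1 : (Prod.fst : B × F → B) ∘ (extChartAt (I.prod J) p).symm =
      (extChartAt I p.1).symm ∘ Prod.fst := by
    rw [extChartAt_prod]; rfl
  have c2 : (Prod.snd : B × F → F) ∘ (extChartAt (I.prod J) p).symm =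
      (extChartAt J p.2).symm ∘ Prod.snd := by
    rw [extChartAt_prod]; rfl
  have D1 : HasMFDerivAt 𝓘(ℝ, E × E') 𝓘(ℝ, E) (Prod.fst : E × E' → E) y
      (ContinuousLinearMap.fst ℝ E E') := (ContinuousLinearMap.fst ℝ E E').hasMFDerivAt
  have D2 : HasMFDerivAt 𝓘(ℝ, E × E') 𝓘(ℝ, E') (Prod.snd : E × E' → E') y
      (ContinuousLinearMap.snd ℝ E E') := (ContinuousLinearMap.snd ℝ E E').hasMFDerivAt
  have A1 : (mfderiv (I.prod J) I Prod.fst ((extChartAt (I.prod J) p).symm y)) ∘L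
      (mfderiv 𝓘(ℝ, E × E') (I.prod J) (extChartAt (I.prod J) p).symm y) =
      (mfderiv 𝓘(ℝ, E) I (extChartAt I p.1).symm y.1) ∘L (ContinuousLinearMap.fst ℝ E E') :=
    (mfderiv_comp y mdifferentiableAt_fst hd).symm.trans
      (HasMFDerivAt.congr_of_eventuallyEq (hd1.hasMFDerivAt.comp y D1)
        (Filter.Eventually.of_forall fun x => congrFun c1 x)).mfderiv
  have A2 : (mfderiv (I.prod J) J Prod.snd ((extChartAt (I.prod J) p).symm y)) ∘L
      (mfderiv 𝓘(ℝ, E × E') (I.prod J) (extChartAt (I.prod J) p).symm y) =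
      (mfderiv 𝓘(ℝ, E') J (extChartAt J p.2).symm y.2) ∘L (ContinuousLinearMap.snd ℝ E E') :=
    (mfderiv_comp y mdifferentiableAt_snd hd).symm.trans
      (HasMFDerivAt.congr_of_eventuallyEq (hd2.hasMFDerivAt.comp y D2)
        (Filter.Eventually.of_forall fun x => congrFun c2 x)).mfderiv
  have B1 : ∀ w : E × E', mfderiv (I.prod J) I Prod.fst ((extChartAt (I.prod J) p).symm y)
      (mfderiv 𝓘(ℝ, E × E') (I.prod J) (extChartAt (I.prod J) p).symm y w) =
      mfderiv 𝓘(ℝ, E) I (extChartAt I p.1).symm y.1 w.1 := fun w =>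
    congrArg (fun L : E × E' →L[ℝ] E => L w) A1
  have B2 : ∀ w : E × E', mfderiv (I.prod J) J Prod.snd ((extChartAt (I.prod J) p).symm y)
      (mfderiv 𝓘(ℝ, E × E') (I.prod J) (extChartAt (I.prod J) p).symm y w) =
      mfderiv 𝓘(ℝ, E') J (extChartAt J p.2).symm y.2 w.2 := fun w =>
    congrArg (fun L : E × E' →L[ℝ] E' => L w) A2
  rw [chartMetric_apply, chartMetric_apply, chartMetric_apply]
  change warpedInner gB gF f _ _ _ = _
  rw [warpedInner_apply, B1, B1, B2, B2]
  have e1 := congrFun c1 y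
  have e2 := congrFun c2 y
  simp only [Function.comp_apply] at e1 e2
  have k1 : ∀ x x' : B, x = x' → ∀ a b : E, gB.inner x a b = gB.inner x' a b := by
    rintro x x' rfl a b; rfl
  have k2 : ∀ x x' : F, x = x' → ∀ a b : E', gF.inner x a b = gF.inner x' a b := by
    rintro x x' rfl a b; rfl
  rw [e1]
  exact congrArg₂ (· + ·) (k1 _ _ e1 _ _) (congrArg _ (k2 _ _ e2 _ _))

end WarpedChart

section WarpedEuclidean

variable {n : ℕ} {E' : Type*} [NormedAddCommGroup E'] [NormedSpace ℝ E']
  {H' : Type*} [TopologicalSpace H'] {J : ModelWithCorners ℝ E' H'} [J.Boundaryless]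
  {F : Type*} [TopologicalSpace F] [ChartedSpace H' F] [IsManifold J ∞ F]
  (gF : ContMDiffRiemannianMetric J ∞ E' (fun y : F => TangentSpace J y))
  {f : EuclideanSpace ℝ (Fin n) → ℝ}
  (hf : ContMDiff 𝓘(ℝ, EuclideanSpace ℝ (Fin n)) 𝓘(ℝ) ∞ f) (hpos : ∀ x, 0 < f x)

theorem chartMetric_euclideanMetric (x y u v : EuclideanSpace ℝ (Fin n)) :
    chartMetric (euclideanMetric n) x y u v = inner ℝ u v := by
  have : mfderiv 𝓘(ℝ, EuclideanSpace ℝ (Fin n)) 𝓘(ℝ, EuclideanSpace ℝ (Fin n))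
      (extChartAt 𝓘(ℝ, EuclideanSpace ℝ (Fin n)) x).symm y = ContinuousLinearMap.id ℝ _ := by
    rw [extChartAt_model_space_eq_id]
    exact mfderiv_id
  refine (chartMetric_apply _ x y u v).trans ?_
  rw [this]
  rfl

theorem chartMetric_warpedMetric_euclideanMetric (p : EuclideanSpace ℝ (Fin n) × F) :
    chartMetric (warpedMetric (euclideanMetric n) gF f hf hpos) p
      =ᶠ[𝓝 (extChartAt (𝓘(ℝ, EuclideanSpace ℝ (Fin n)).prod J) p p)]
        localWarped f (chartMetric gF p.2) := by
  filter_upwards [(isOpen_extChartAt_target p).mem_nhds (mem_extChartAt_target p)] with y hy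
  refine ContinuousLinearMap.ext fun u => ContinuousLinearMap.ext fun v => ?_
  rw [chartMetric_warpedMetric _ _ _ _ _ _ hy, chartMetric_euclideanMetric, localWarped_apply,
    extChartAt_model_space_eq_id]
  rfl

end WarpedEuclidean

/-! ### Ricci tensor and Hessian of a warped product over Euclidean space -/

section WarpedTensors

variable {n : ℕ} {E' : Type*} [NormedAddCommGroup E'] [NormedSpace ℝ E'] [FiniteDimensional ℝ E']
  {H' : Type*} [TopologicalSpace H'] {J : ModelWithCorners ℝ E' H'} [J.Boundaryless]
  {F : Type*} [TopologicalSpace F] [ChartedSpace H' F] [IsManifold J ∞ F]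
  (gF : ContMDiffRiemannianMetric J ∞ E' (fun y : F => TangentSpace J y))
  {f : EuclideanSpace ℝ (Fin n) → ℝ}
  (hf : ContMDiff 𝓘(ℝ, EuclideanSpace ℝ (Fin n)) 𝓘(ℝ) ∞ f) (hpos : ∀ x, 0 < f x)

omit [FiniteDimensional ℝ E'] [J.Boundaryless] in
-- The preferred chart has identity derivative at its own centre, so tangent vectors need no
-- conversion.
theorem ricciTensor_eq_localRicci (q : F) (v w : E') :
    ricciTensor gF q v w = localRicci (chartMetric gF q) (extChartAt J q q) v w := by
  have key : ∀ L : E' →L[ℝ] E', L = ContinuousLinearMap.id ℝ E' →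
      localRicci (chartMetric gF q) (extChartAt J q q) (L v) (L w) =
        localRicci (chartMetric gF q) (extChartAt J q q) v w := by
    rintro _ rfl; rfl
  unfold ricciTensor
  exact key _ (mfderiv_extChartAt_self (I := J) (x := q))

omit [FiniteDimensional ℝ E'] [J.Boundaryless] in
theorem hessian_eq_localHessian (h : F → ℝ) (q : F) (v w : E') :
    hessian gF h q v w =
      localHessian (chartMetric gF q) (h ∘ (extChartAt J q).symm) (extChartAt J q q) v w := by
  have key : ∀ L : E' →L[ℝ] E', L = ContinuousLinearMap.id ℝ E' →
      localHessian (chartMetric gF q) (h ∘ (extChartAt J q).symm) (extChartAt J q q) (L v) (L w) =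
        localHessian (chartMetric gF q) (h ∘ (extChartAt J q).symm) (extChartAt J q q) v w := by
    rintro _ rfl; rfl
  unfold hessian
  exact key _ (mfderiv_extChartAt_self (I := J) (x := q))

omit [FiniteDimensional ℝ E'] [IsManifold J ∞ F] [J.Boundaryless] in
theorem extChartAt_prod_model_space_self
    (p : EuclideanSpace ℝ (Fin n) × F) :
    extChartAt (𝓘(ℝ, EuclideanSpace ℝ (Fin n)).prod J) p p = (p.1, extChartAt J p.2 p.2) := by
  rw [extChartAt_prod, extChartAt_model_space_eq_id]
  rfl

omit [FiniteDimensional ℝ E'] in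
theorem eventually_chartMetric_pos (q : F) : ∀ᶠ z in 𝓝 (extChartAt J q q),
    ∀ u, u ≠ 0 → 0 < chartMetric gF q z u u := by
  filter_upwards [(isOpen_extChartAt_target q).mem_nhds (mem_extChartAt_target q)] with z hz
  exact chartMetric_pos gF hz

/-- The Ricci tensor of a warped product over Euclidean space: here `N` is the gradient of the
warping function `f` and `N'` is its differential at the base point. -/
theorem ricciTensor_warpedMetric_euclideanMetric
    {N : EuclideanSpace ℝ (Fin n) → EuclideanSpace ℝ (Fin n)}
    {N' : EuclideanSpace ℝ (Fin n) →L[ℝ] EuclideanSpace ℝ (Fin n)}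
    (hN : ∀ x, HasFDerivAt f (innerSL ℝ (N x)) x) (p : EuclideanSpace ℝ (Fin n) × F)
    (hN' : HasFDerivAt N N' p.1) (v w : EuclideanSpace ℝ (Fin n) × E') :
    ricciTensor (warpedMetric (euclideanMetric n) gF f hf hpos) p v w =
      ricciTensor gF p.2 v.2 w.2 - Module.finrank ℝ E' / f p.1 * inner ℝ (N' v.1) w.1
        - (f p.1 * LinearMap.trace ℝ (EuclideanSpace ℝ (Fin n)) N'
          + (Module.finrank ℝ E' - 1) * ‖N p.1‖ ^ 2) * gF.inner p.2 v.2 w.2 := by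
  rw [ricciTensor_eq_localRicci, ricciTensor_eq_localRicci,
    localRicci_congr (chartMetric_warpedMetric_euclideanMetric gF hf hpos p),
    extChartAt_prod_model_space_self,
    localRicci_localWarped (y := (p.1, extChartAt J p.2 p.2)) hf.contDiff (fun x => (hpos x).ne') hN hN'
      (contDiffAt_chartMetric gF p.2) (eventually_chartMetric_pos gF p.2)
      (Filter.Eventually.of_forall fun z u v => chartMetric_symm gF p.2 z u v)]
  rw [chartMetric_extChartAt_self]

/-- The Hessian, in a warped product over Euclidean space, of a function on the base. -/
theorem hessian_warpedMetric_euclideanMetric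
    {N : EuclideanSpace ℝ (Fin n) → EuclideanSpace ℝ (Fin n)}
    (hN : ∀ x, HasFDerivAt f (innerSL ℝ (N x)) x)
    {h : EuclideanSpace ℝ (Fin n) → ℝ} (hh : ContDiff ℝ ∞ h)
    (p : EuclideanSpace ℝ (Fin n) × F) (v w : EuclideanSpace ℝ (Fin n) × E') :
    hessian (warpedMetric (euclideanMetric n) gF f hf hpos) (fun q => h q.1) p v w =
      fderiv ℝ (fderiv ℝ h) p.1 v.1 w.1
        + f p.1 * gF.inner p.2 v.2 w.2 * fderiv ℝ h p.1 (N p.1) := by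
  have e : (fun q : EuclideanSpace ℝ (Fin n) × F => h q.1) ∘
      (extChartAt (𝓘(ℝ, EuclideanSpace ℝ (Fin n)).prod J) p).symm = fun z => h z.1 := by
    rw [extChartAt_prod, extChartAt_model_space_eq_id]
    rfl
  rw [hessian_eq_localHessian,
    localHessian_congr (chartMetric_warpedMetric_euclideanMetric gF hf hpos p),
    extChartAt_prod_model_space_self, e,
    localHessian_localWarped (y := (p.1, extChartAt J p.2 p.2)) hh (hpos _).ne' (hN _)
      ((contDiffAt_chartMetric gF p.2).differentiableAt (by simp))
      (eventually_chartMetric_pos gF p.2).self_of_nhds]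
  rw [chartMetric_extChartAt_self]

omit [FiniteDimensional ℝ E'] [J.Boundaryless] in
theorem warpedMetric_euclideanMetric_inner (p : EuclideanSpace ℝ (Fin n) × F)
    (v w : EuclideanSpace ℝ (Fin n) × E') :
    (warpedMetric (euclideanMetric n) gF f hf hpos).inner p v w =
      inner ℝ v.1 w.1 + f p.1 ^ 2 * gF.inner p.2 v.2 w.2 := by
  refine (warpedInner_apply (euclideanMetric n) gF f p v w).trans ?_
  rw [mfderiv_fst, mfderiv_snd]
  rfl

end WarpedTensors

/-! ### Derivatives of the warping function and the potential -/

section ExplicitFunctions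

variable {n : ℕ}

/-- The vector `(1, …, 1)` of `ℝⁿ`. -/
def onesVector (n : ℕ) : EuclideanSpace ℝ (Fin n) := WithLp.toLp 2 fun _ => 1

theorem inner_onesVector (x : EuclideanSpace ℝ (Fin n)) : inner ℝ (onesVector n) x = ∑ k, x k := by
  simp [onesVector, PiLp.inner_apply]

theorem inner_onesVector_self : inner ℝ (onesVector n) (onesVector n) = (n : ℝ) := by
  rw [inner_onesVector]
  simp [onesVector]

theorem norm_onesVector_sq : ‖onesVector n‖ ^ 2 = (n : ℝ) := by
  rw [← real_inner_self_eq_norm_sq, inner_onesVector_self]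

theorem expWarping_eq (m : ℕ) (a a₁ a₂ : ℝ) :
    expWarping n m a a₁ a₂ = fun x => a₁ * Real.exp (√(a / m) * inner ℝ (onesVector n) x)
      + a₂ * Real.exp (-(√(a / m) * inner ℝ (onesVector n) x)) := by
  funext x
  rw [expWarping, inner_onesVector]

theorem hasFDerivAt_inner_const (z x : EuclideanSpace ℝ (Fin n)) :
    HasFDerivAt (fun x => inner ℝ z x) (innerSL ℝ z) x :=
  (innerSL ℝ z).hasFDerivAt

/-- `expWarping` with weights `a₁`, `-a₂` gives, up to a constant factor, the slope of `expWarping`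
with weights `a₁`, `a₂`. -/
theorem hasFDerivAt_expWarping (m : ℕ) (a a₁ a₂ : ℝ) (x : EuclideanSpace ℝ (Fin n)) :
    HasFDerivAt (expWarping n m a a₁ a₂)
      ((√(a / m) * expWarping n m a a₁ (-a₂) x) • innerSL ℝ (onesVector n)) x := by
  simp only [expWarping_eq]
  have h := (hasFDerivAt_inner_const (onesVector n) x).const_mul √(a / m)
  refine ((h.exp.const_mul a₁).add (h.neg.exp.const_mul a₂)).congr_fderiv ?_
  module

/-- This is (A - B)² = (A + B)² - 4AB, where the two exponentials cancel in AB. It is the source of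
the constant 4a₁a₂ in the Einstein condition. -/
theorem sq_expWarping_neg (m : ℕ) (a a₁ a₂ : ℝ) (x : EuclideanSpace ℝ (Fin n)) :
    expWarping n m a a₁ (-a₂) x ^ 2 = expWarping n m a a₁ a₂ x ^ 2 - 4 * a₁ * a₂ := by
  have h : Real.exp (√(a / m) * ∑ k, x k) * Real.exp (-(√(a / m) * ∑ k, x k)) = 1 := by
    rw [← Real.exp_add, add_neg_cancel, Real.exp_zero]
  unfold expWarping
  linear_combination (-4 * a₁ * a₂) * h

/-- The gradient of `expWarping`. -/
def expWarpingGradient (n m : ℕ) (a a₁ a₂ : ℝ) (x : EuclideanSpace ℝ (Fin n)) :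
    EuclideanSpace ℝ (Fin n) :=
  (√(a / m) * expWarping n m a a₁ (-a₂) x) • onesVector n

theorem hasFDerivAt_expWarping_gradient (m : ℕ) (a a₁ a₂ : ℝ) (x : EuclideanSpace ℝ (Fin n)) :
    HasFDerivAt (expWarping n m a a₁ a₂) (innerSL ℝ (expWarpingGradient n m a a₁ a₂ x)) x := by
  refine (hasFDerivAt_expWarping m a a₁ a₂ x).congr_fderiv ?_
  rw [expWarpingGradient, map_smul]

/-- Each derivative flips the sign of the second weight, so two derivatives restore `f`, with factor
√(a/m)² = a/m. -/
theorem hasFDerivAt_expWarpingGradient {m : ℕ} {a : ℝ} (ha : 0 ≤ a) (a₁ a₂ : ℝ)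
    (x : EuclideanSpace ℝ (Fin n)) :
    HasFDerivAt (expWarpingGradient n m a a₁ a₂)
      ((a / m * expWarping n m a a₁ a₂ x) •
        (innerSL ℝ (onesVector n)).smulRight (onesVector n)) x := by
  have h := ((hasFDerivAt_expWarping m a a₁ (-a₂) x).const_mul √(a / m)).smul_const
    (onesVector n)
  refine h.congr_fderiv ?_
  rw [neg_neg, smul_smul, ← mul_assoc, Real.mul_self_sqrt (by positivity)]
  ext v
  simp [mul_assoc]

theorem sum_sum_Ioi_mul (x : Fin n → ℝ) :
    ∑ k, ∑ l ∈ Finset.Ioi k, x k * x l = ((∑ k, x k) ^ 2 - ∑ k, x k ^ 2) / 2 := by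
  have h1 : (∑ k, x k) ^ 2 = ∑ k, ∑ l, x k * x l := by rw [sq, Finset.sum_mul_sum]
  have h2 : ∀ k, ∑ l, x k * x l =
      ∑ l ∈ Finset.Ioi k, x k * x l + ∑ l ∈ Finset.Iio k, x k * x l + x k ^ 2 := by
    intro k
    have e : ∀ l, x k * x l = (if k < l then x k * x l else 0)
        + (if l < k then x k * x l else 0) + (if k = l then x k ^ 2 else 0) := by
      intro l
      rcases lt_trichotomy k l with h | h | h
      · simp [h, h.ne, h.not_gt]
      · subst h; simp [sq]
      · simp [h, h.ne', h.not_gt]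
    rw [Finset.sum_congr rfl fun l _ => e l, Finset.sum_add_distrib, Finset.sum_add_distrib,
      ← Finset.sum_filter, ← Finset.sum_filter, Finset.sum_ite_eq]
    simp [Finset.filter_lt_eq_Ioi, Finset.filter_gt_eq_Iio]
  have h3 : ∑ k, ∑ l ∈ Finset.Iio k, x k * x l = ∑ k, ∑ l ∈ Finset.Ioi k, x k * x l := by
    rw [Finset.sum_comm' (t' := Finset.univ) (s' := fun l => Finset.Ioi l) (by simp)]
    exact Finset.sum_congr rfl fun k _ => Finset.sum_congr rfl fun l _ => mul_comm _ _
  rw [h1, Finset.sum_congr rfl fun k _ => h2 k, Finset.sum_add_distrib, Finset.sum_add_distrib, h3]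
  ring

/-- The mixed products are half of ξ² - |x|², which raises the coefficient n - 1 to n and exposes
the Hessian -na g₀ + a e⊗e. -/
theorem quadraticPotential_eq (a b : ℝ) (c : Fin n → ℝ) :
    quadraticPotential n a b c = fun x => -(n * a / 2) * inner ℝ x x
      + a / 2 * inner ℝ (onesVector n) x ^ 2 + inner ℝ (WithLp.toLp 2 c) x + b := by
  funext x
  have h1 : inner ℝ x x = ∑ k, x k ^ 2 := by
    rw [real_inner_self_eq_norm_sq, EuclideanSpace.real_norm_sq_eq]
  have h2 : inner ℝ (WithLp.toLp 2 c) x = ∑ k, c k * x k := by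
    rw [PiLp.inner_apply]
    exact Finset.sum_congr rfl fun k _ => mul_comm _ _
  rw [quadraticPotential, inner_onesVector, h1, h2, sum_sum_Ioi_mul]
  ring

theorem contDiff_quadraticPotential (a b : ℝ) (c : Fin n → ℝ) :
    ContDiff ℝ ∞ (quadraticPotential n a b c) := by
  unfold quadraticPotential
  fun_prop

theorem fderiv_quadraticPotential (a b : ℝ) (c : Fin n → ℝ) :
    fderiv ℝ (quadraticPotential n a b c) = fun x => (-(n * a)) • innerSL ℝ x
      + (a * inner ℝ (onesVector n) x) • innerSL ℝ (onesVector n)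
      + innerSL ℝ (WithLp.toLp 2 c) := by
  funext x
  rw [quadraticPotential_eq]
  have h := ((((hasFDerivAt_id x).inner ℝ (hasFDerivAt_id x)).const_mul (-(n * a / 2))).add
    (((hasFDerivAt_inner_const (onesVector n) x).pow 2).const_mul (a / 2))).add
    (hasFDerivAt_inner_const (WithLp.toLp 2 c) x) |>.add_const b
  refine h.fderiv.trans ?_
  ext v
  simp [innerSL_apply_apply, real_inner_comm]
  ring

theorem fderiv_fderiv_quadraticPotential (a b : ℝ) (c : Fin n → ℝ)
    (x v w : EuclideanSpace ℝ (Fin n)) :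
    fderiv ℝ (fderiv ℝ (quadraticPotential n a b c)) x v w =
      -(n * a) * inner ℝ v w + a * inner ℝ (onesVector n) v * inner ℝ (onesVector n) w := by
  rw [fderiv_quadraticPotential]
  have h := (((innerSL ℝ (E := EuclideanSpace ℝ (Fin n))).hasFDerivAt (x := x)).const_smul
    (-(n * a))).add (((hasFDerivAt_inner_const (onesVector n) x).const_mul a).smul_const
      (innerSL ℝ (onesVector n))) |>.add_const (innerSL ℝ (WithLp.toLp 2 c))
  refine (congrArg (fun L : EuclideanSpace ℝ (Fin n) →L[ℝ] EuclideanSpace ℝ (Fin n) →L[ℝ] ℝ =>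
    L v w) h.fderiv).trans ?_
  simp [innerSL_apply_apply]
  exact Or.inl rfl

/-- Along e the derivative is -naξ + aξ|e|² + ∑ cₖ with |e|² = n. As ∇f is parallel to e, the fibre
part of Hess h vanishes. -/
theorem fderiv_quadraticPotential_onesVector (a b : ℝ) {c : Fin n → ℝ} (hc : ∑ k, c k = 0)
    (x : EuclideanSpace ℝ (Fin n)) :
    fderiv ℝ (quadraticPotential n a b c) x (onesVector n) = 0 := by
  rw [fderiv_quadraticPotential]
  have h : inner ℝ (WithLp.toLp 2 c) (onesVector n) = (0 : ℝ) := by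
    rw [real_inner_comm, inner_onesVector]
    exact hc
  simp [innerSL_apply_apply, h, norm_onesVector_sq, real_inner_comm (onesVector n) x]
  ring

end ExplicitFunctions

/-! ### The soliton equation -/

section Soliton

variable {n m : ℕ} {F : Type*} [TopologicalSpace F] [ChartedSpace (EuclideanSpace ℝ (Fin m)) F]
  [IsManifold 𝓘(ℝ, EuclideanSpace ℝ (Fin m)) ∞ F]

theorem isExpandingGradientRicciSoliton_warpedMetric (hn : 2 ≤ n) (hm : 1 ≤ m)
    (gF : ContMDiffRiemannianMetric 𝓘(ℝ, EuclideanSpace ℝ (Fin m)) ∞ (EuclideanSpace ℝ (Fin m))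
      (fun y : F => TangentSpace 𝓘(ℝ, EuclideanSpace ℝ (Fin m)) y))
    (a a₁ a₂ b : ℝ) (c : Fin n → ℝ) (ha : 0 < a) (hc : ∑ k, c k = 0)
    (hpos : ∀ x, 0 < expWarping n m a a₁ a₂ x)
    (hF : IsEinstein gF (4 * a₁ * a₂ * (-(n * a)) * ((m - 1) / m))) :
    IsExpandingGradientRicciSoliton
      (warpedMetric (euclideanMetric n) gF (expWarping n m a a₁ a₂)
        (contMDiff_expWarping n m a a₁ a₂) hpos)
      (fun p => quadraticPotential n a b c p.1) (-(n * a)) where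
  three_le_dim := by
    rw [Module.finrank_prod, finrank_euclideanSpace_fin, finrank_euclideanSpace_fin]
    omega
  smooth := (contDiff_quadraticPotential a b c).contMDiff.comp contMDiff_fst
  eqn p v w := by
    have hN' := hasFDerivAt_expWarpingGradient (n := n) (m := m) ha.le a₁ a₂ p.1
    have hE := hF p.2 (show EuclideanSpace ℝ (Fin n) × EuclideanSpace ℝ (Fin m) from v).2
      (show EuclideanSpace ℝ (Fin n) × EuclideanSpace ℝ (Fin m) from w).2
    have hR := ricciTensor_warpedMetric_euclideanMetric gF (contMDiff_expWarping n m a a₁ a₂) hpos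
      (hasFDerivAt_expWarping_gradient m a a₁ a₂) p hN' v w
    have hH := hessian_warpedMetric_euclideanMetric gF (contMDiff_expWarping n m a a₁ a₂) hpos
      (hasFDerivAt_expWarping_gradient m a a₁ a₂) (contDiff_quadraticPotential a b c) p v w
    have hI := warpedMetric_euclideanMetric_inner gF (contMDiff_expWarping n m a a₁ a₂) hpos p v w
    have hm0 : (m : ℝ) ≠ 0 := by positivity
    have hf0 := (hpos p.1).ne'
    have hT : LinearMap.trace ℝ (EuclideanSpace ℝ (Fin n))
        (((a / m * expWarping n m a a₁ a₂ p.1) •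
          (innerSL ℝ (onesVector n)).smulRight (onesVector n) :
            EuclideanSpace ℝ (Fin n) →L[ℝ] EuclideanSpace ℝ (Fin n)) :
          EuclideanSpace ℝ (Fin n) →ₗ[ℝ] EuclideanSpace ℝ (Fin n)) =
        a / m * expWarping n m a a₁ a₂ p.1 * n := by
      have e := LinearMap.trace_smulRight
        (innerSL ℝ (onesVector n) : EuclideanSpace ℝ (Fin n) →ₗ[ℝ] ℝ) (onesVector n)
      rw [ContinuousLinearMap.coe_coe, innerSL_apply_apply, inner_onesVector_self] at e
      rw [ContinuousLinearMap.toLinearMap_smul, map_smul, smul_eq_mul]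
      exact congrArg _ e
    have hNn : ‖expWarpingGradient n m a a₁ a₂ p.1‖ ^ 2 =
        a / m * (expWarping n m a a₁ a₂ p.1 ^ 2 - 4 * a₁ * a₂) * n := by
      rw [expWarpingGradient, norm_smul, mul_pow, norm_onesVector_sq, Real.norm_eq_abs, sq_abs,
        mul_pow, Real.sq_sqrt (by positivity), sq_expWarping_neg]
    have hD : fderiv ℝ (quadraticPotential n a b c) p.1 (expWarpingGradient n m a a₁ a₂ p.1)
        = 0 := by
      rw [expWarpingGradient, map_smul, fderiv_quadraticPotential_onesVector a b hc, smul_zero]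
    refine (congrArg₂ (· + ·) hR hH).trans (Eq.trans ?_ (congrArg (-(n * a) * ·) hI).symm)
    rw [hE, hT, hNn, hD, fderiv_fderiv_quadraticPotential, finrank_euclideanSpace_fin]
    simp only [smul_apply, ContinuousLinearMap.smulRight_apply, innerSL_apply_apply,
      inner_smul_left, RCLike.conj_to_real]
    field_simp
    ring
  expanding := by
    have : 0 < (n : ℝ) := by positivity
    nlinarith

end Soliton

/-! ### Lengths of paths -/

section PathLength

open MeasureTheory

variable {E : Type*} [NormedAddCommGroup E] [NormedSpace ℝ E]
  {H : Type*} [TopologicalSpace H] {I : ModelWithCorners ℝ E H}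
  {M : Type*} [TopologicalSpace M] [ChartedSpace H M] [IsManifold I ∞ M]
  (g : ContMDiffRiemannianMetric I ∞ E (fun x : M => TangentSpace I x))

/-- The length of a path `γ` on `[0, 1]` with respect to the metric `g`. -/
def metricLength (γ : ℝ → M) : ℝ≥0∞ :=
  ∫⁻ t in Ioo (0 : ℝ) 1, ENNReal.ofReal
    √(g.inner (γ t) (mfderiv 𝓘(ℝ, ℝ) I γ t (1 : ℝ)) (mfderiv 𝓘(ℝ, ℝ) I γ t (1 : ℝ)))

/-- Confines the `RiemannianBundle` instance to this section, so that lengths for different metrics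
can later be compared in one statement. -/
theorem metricLength_eq_pathELength (γ : ℝ → M) :
    letI : RiemannianBundle (fun x : M => TangentSpace I x) := ⟨g.toRiemannianMetric⟩
    metricLength g γ = pathELength I γ 0 1 := by
  let : RiemannianBundle (fun x : M => TangentSpace I x) := ⟨g.toRiemannianMetric⟩
  rw [pathELength_eq_lintegral_mfderiv_Ioo, metricLength]
  refine lintegral_congr fun t => ?_
  rw [← ofReal_norm, norm_eq_sqrt_real_inner]
  rfl

theorem metricEDist_le_metricLength {x y : M} {γ : ℝ → M}
    (hγ : ContMDiffOn 𝓘(ℝ, ℝ) I 1 γ (Icc 0 1)) (h0 : γ 0 = x) (h1 : γ 1 = y) :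
    metricEDist g x y ≤ metricLength g γ := by
  let : RiemannianBundle (fun x : M => TangentSpace I x) := ⟨g.toRiemannianMetric⟩
  rw [metricLength_eq_pathELength]
  exact riemannianEDist_le_pathELength hγ h0 h1 zero_le_one

theorem exists_metricLength_lt {x y : M} {r : ℝ≥0∞} (h : metricEDist g x y < r) :
    ∃ γ : ℝ → M, γ 0 = x ∧ γ 1 = y ∧ ContMDiffOn 𝓘(ℝ, ℝ) I 1 γ (Icc 0 1) ∧
      metricLength g γ < r := by
  let : RiemannianBundle (fun x : M => TangentSpace I x) := ⟨g.toRiemannianMetric⟩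
  obtain ⟨γ, h0, h1, hγ, hl⟩ := exists_lt_of_riemannianEDist_lt h
  refine ⟨γ, h0, h1, hγ, ?_⟩
  rwa [metricLength_eq_pathELength]

end PathLength

/-! ### Completeness of the warped product -/

section Completeness

open MeasureTheory

variable {n : ℕ} {E' : Type*} [NormedAddCommGroup E'] [NormedSpace ℝ E']
  {H' : Type*} [TopologicalSpace H'] {J : ModelWithCorners ℝ E' H'}
  {F : Type*} [TopologicalSpace F] [ChartedSpace H' F] [IsManifold J ∞ F]
  (gF : ContMDiffRiemannianMetric J ∞ E' (fun y : F => TangentSpace J y))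
  {f : EuclideanSpace ℝ (Fin n) → ℝ}
  (hf : ContMDiff 𝓘(ℝ, EuclideanSpace ℝ (Fin n)) 𝓘(ℝ) ∞ f) (hpos : ∀ x, 0 < f x)
  {γ : ℝ → EuclideanSpace ℝ (Fin n) × F}

theorem warpedMetric_inner_mfderiv {t : ℝ}
    (hγ : MDifferentiableAt 𝓘(ℝ, ℝ) (𝓘(ℝ, EuclideanSpace ℝ (Fin n)).prod J) γ t) :
    (warpedMetric (euclideanMetric n) gF f hf hpos).inner (γ t)
        (mfderiv 𝓘(ℝ, ℝ) (𝓘(ℝ, EuclideanSpace ℝ (Fin n)).prod J) γ t (1 : ℝ))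
        (mfderiv 𝓘(ℝ, ℝ) (𝓘(ℝ, EuclideanSpace ℝ (Fin n)).prod J) γ t (1 : ℝ)) =
      ‖deriv (fun s => (γ s).1) t‖ ^ 2 + f (γ t).1 ^ 2 *
        gF.inner (γ t).2 (mfderiv 𝓘(ℝ, ℝ) J (fun s => (γ s).2) t (1 : ℝ))
          (mfderiv 𝓘(ℝ, ℝ) J (fun s => (γ s).2) t (1 : ℝ)) := by
  refine (warpedInner_apply (euclideanMetric n) gF f (γ t) _ _).trans ?_
  have h1 : mfderiv 𝓘(ℝ, ℝ) 𝓘(ℝ, EuclideanSpace ℝ (Fin n)) (fun s => (γ s).1) t = _ :=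
    mfderiv_comp t mdifferentiableAt_fst hγ
  have h2 : mfderiv 𝓘(ℝ, ℝ) J (fun s => (γ s).2) t = _ :=
    mfderiv_comp t mdifferentiableAt_snd hγ
  have e1 : deriv (fun s => (γ s).1) t =
      mfderiv 𝓘(ℝ, ℝ) 𝓘(ℝ, EuclideanSpace ℝ (Fin n)) (fun s => (γ s).1) t (1 : ℝ) := by
    rw [mfderiv_eq_fderiv]
    exact fderiv_apply_one_eq_deriv.symm
  rw [← real_inner_self_eq_norm_sq, e1, h1, h2]
  rfl

omit [IsManifold J ∞ F] in
theorem mdifferentiableAt_of_contMDiffOn_Icc {t : ℝ} (ht : t ∈ Ioo (0 : ℝ) 1)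
    (hγ : ContMDiffOn 𝓘(ℝ, ℝ) (𝓘(ℝ, EuclideanSpace ℝ (Fin n)).prod J) 1 γ (Icc 0 1)) :
    MDifferentiableAt 𝓘(ℝ, ℝ) (𝓘(ℝ, EuclideanSpace ℝ (Fin n)).prod J) γ t :=
  (hγ.contMDiffAt (Icc_mem_nhds ht.1 ht.2)).mdifferentiableAt one_ne_zero

/-- The base speed is at most the full speed. Intermediate times `s` are allowed so that the whole
projected path can be confined to a ball. -/
theorem edist_fst_le_metricLength
    (hγ : ContMDiffOn 𝓘(ℝ, ℝ) (𝓘(ℝ, EuclideanSpace ℝ (Fin n)).prod J) 1 γ (Icc 0 1))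
    {s : ℝ} (hs : s ∈ Icc (0 : ℝ) 1) :
    edist (γ 0).1 (γ s).1 ≤ metricLength (warpedMetric (euclideanMetric n) gF f hf hpos) γ := by
  have hc : ContDiffOn ℝ 1 (fun s => (γ s).1) (Icc 0 1) :=
    contMDiffOn_iff_contDiffOn.1 (contMDiff_fst.comp_contMDiffOn hγ)
  rw [edist_comm, edist_eq_enorm_sub]
  refine (enorm_sub_le_lintegral_deriv_of_contDiffOn_Icc
    (hc.mono (Icc_subset_Icc le_rfl hs.2)) hs.1).trans ?_
  refine (lintegral_mono_set (Icc_subset_Icc le_rfl hs.2)).trans ?_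
  -- The endpoints are null, and only at interior times is the path known to be differentiable.
  rw [← restrict_Ioo_eq_restrict_Icc]
  refine setLIntegral_mono' measurableSet_Ioo fun t ht => ?_
  rw [warpedMetric_inner_mfderiv gF hf hpos (mdifferentiableAt_of_contMDiffOn_Icc ht hγ),
    ← ofReal_norm]
  refine ENNReal.ofReal_le_ofReal (Real.le_sqrt_of_sq_le ?_)
  exact le_add_of_nonneg_right (mul_nonneg (sq_nonneg _) (inner_self_nonneg' gF _ _))

theorem mul_metricLength_snd_le
    (hγ : ContMDiffOn 𝓘(ℝ, ℝ) (𝓘(ℝ, EuclideanSpace ℝ (Fin n)).prod J) 1 γ (Icc 0 1))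
    {δ : ℝ} (hδ : 0 ≤ δ) (h : ∀ t ∈ Icc (0 : ℝ) 1, δ ≤ f (γ t).1) :
    ENNReal.ofReal δ * metricLength gF (fun s => (γ s).2) ≤
      metricLength (warpedMetric (euclideanMetric n) gF f hf hpos) γ := by
  -- This direction needs no measurability of the speed.
  refine (lintegral_const_mul_le _ _).trans ?_
  refine setLIntegral_mono' measurableSet_Ioo fun t ht => ?_
  rw [warpedMetric_inner_mfderiv gF hf hpos (mdifferentiableAt_of_contMDiffOn_Icc ht hγ),
    ← ENNReal.ofReal_mul hδ]
  refine ENNReal.ofReal_le_ofReal (Real.le_sqrt_of_sq_le ?_)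
  have h0 := inner_self_nonneg' gF (γ t).2 (mfderiv 𝓘(ℝ, ℝ) J (fun s => (γ s).2) t (1 : ℝ))
  rw [mul_pow, Real.sq_sqrt h0]
  have h1 : δ ^ 2 ≤ f (γ t).1 ^ 2 := pow_le_pow_left₀ hδ (h t ⟨ht.1.le, ht.2.le⟩) 2
  exact le_add_of_nonneg_of_le (sq_nonneg _) (mul_le_mul_of_nonneg_right h1 h0)

theorem edist_fst_le_metricEDist (p q : EuclideanSpace ℝ (Fin n) × F) :
    edist p.1 q.1 ≤ metricEDist (warpedMetric (euclideanMetric n) gF f hf hpos) p q := by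
  refine le_of_forall_gt fun r hr => ?_
  obtain ⟨γ, rfl, rfl, hγ, hl⟩ := exists_metricLength_lt _ hr
  exact (edist_fst_le_metricLength gF hf hpos hγ (right_mem_Icc.2 zero_le_one)).trans_lt hl

/-- A warped product of Euclidean space with a complete fibre is complete. -/
theorem isCompleteRiemannian_warpedMetric (hF : IsCompleteRiemannian gF) :
    IsCompleteRiemannian (warpedMetric (euclideanMetric n) gF f hf hpos) := by
  intro u hu
  have hc1 : CauchySeq fun k => (u k).1 := by
    refine EMetric.cauchySeq_iff.2 fun ε hε => ?_
    obtain ⟨N, hN⟩ := hu ε hε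
    exact ⟨N, fun j hj k hk => (edist_fst_le_metricEDist gF hf hpos _ _).trans_lt (hN j hj k hk)⟩
  obtain ⟨x, hx⟩ := cauchySeq_tendsto_of_complete hc1
  obtain ⟨N₀, hN₀⟩ := Filter.eventually_atTop.1
    ((EMetric.tendsto_nhds.1 hx) 1 one_pos)
  -- The radius is 2 = 1 + 1: late base points lie within 1 of the limit, and the connecting paths
  -- will have length below 1.
  obtain ⟨z, -, hz⟩ := (isCompact_closedBall x 2).exists_isMinOn
    ⟨x, Metric.mem_closedBall_self zero_le_two⟩ hf.continuous.continuousOn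
  have hδ : 0 < ENNReal.ofReal (f z) := ENNReal.ofReal_pos.2 (hpos z)
  have hc2 : ∀ ε > 0, ∃ N, ∀ j ≥ N, ∀ k ≥ N, metricEDist gF (u j).2 (u k).2 < ε := by
    intro ε hε
    -- The bound 1 keeps paths in the ball; the bound `f z * ε` gives fibre length below `ε`.
    obtain ⟨N, hN⟩ := hu (min 1 (ENNReal.ofReal (f z) * ε))
      (lt_min one_pos (ENNReal.mul_pos hδ.ne' hε.ne'))
    refine ⟨max N N₀, fun j hj k hk => ?_⟩
    obtain ⟨γ, h0, h1, hγ, hl⟩ := exists_metricLength_lt _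
      (hN j (le_of_max_le_left hj) k (le_of_max_le_left hk))
    have hball : ∀ t ∈ Icc (0 : ℝ) 1, f z ≤ f (γ t).1 := by
      intro t ht
      refine hz ?_
      have hd := edist_fst_le_metricLength gF hf hpos hγ ht
      have hd' : edist (γ t).1 x ≤ 1 + 1 := by
        refine (edist_triangle _ (γ 0).1 _).trans (add_le_add ?_ ?_)
        · rw [edist_comm]
          exact hd.trans (hl.le.trans (min_le_left _ _))
        · rw [h0]
          exact (hN₀ j (le_of_max_le_right hj)).le
      rw [edist_dist, one_add_one_eq_two, ENNReal.ofReal_le_iff_le_toReal (by simp)] at hd'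
      exact hd'
    have hl2 := mul_metricLength_snd_le gF hf hpos hγ (hpos z).le hball
    refine (metricEDist_le_metricLength gF (γ := fun s => (γ s).2)
      (contMDiff_snd.comp_contMDiffOn hγ) (by rw [h0]) (by rw [h1])).trans_lt ?_
    -- Multiplying by the minimum of `f` and contradicting the length bound avoids division in
    -- `ℝ≥0∞`.
    by_contra hcon
    exact absurd ((mul_le_mul_right (not_lt.1 hcon) _).trans hl2)
      (not_le.2 (hl.trans_le (min_le_right _ _)))
  obtain ⟨y, hy⟩ := hF (fun k => (u k).2) hc2
  exact ⟨(x, y), hx.prodMk_nhds hy⟩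

end Completeness

end

theorem mainTheorem4 {n m : ℕ} (hn : 2 ≤ n) (hm : 1 ≤ m)
    {F : Type*} [TopologicalSpace F] [T2Space F] [ChartedSpace (EuclideanSpace ℝ (Fin m)) F]
    [IsManifold 𝓘(ℝ, EuclideanSpace ℝ (Fin m)) ∞ F]
    (gF : ContMDiffRiemannianMetric 𝓘(ℝ, EuclideanSpace ℝ (Fin m)) ∞ (EuclideanSpace ℝ (Fin m))
      (fun y : F => TangentSpace 𝓘(ℝ, EuclideanSpace ℝ (Fin m)) y))
    (a a₁ a₂ b ρ : ℝ) (c : Fin n → ℝ) (ha : 0 < a) (hc : ∑ k, c k = 0)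
    (hpos : ∀ x, 0 < expWarping n m a a₁ a₂ x)
    (hρ : ρ = -(n * a))
    (hF : IsEinstein gF (4 * a₁ * a₂ * ρ * ((m - 1) / m))) :
    IsExpandingGradientRicciSoliton
      (warpedMetric (euclideanMetric n) gF (expWarping n m a a₁ a₂)
        (contMDiff_expWarping n m a a₁ a₂) hpos)
      (fun p => quadraticPotential n a b c p.1) ρ ∧
    (IsCompleteRiemannian gF →
      IsCompleteRiemannian
        (warpedMetric (euclideanMetric n) gF (expWarping n m a a₁ a₂)
          (contMDiff_expWarping n m a a₁ a₂) hpos)) := by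
  subst hρ
  exact ⟨isExpandingGradientRicciSoliton_warpedMetric hn hm gF a a₁ a₂ b c ha hc hpos hF,
    isCompleteRiemannian_warpedMetric gF _ hpos⟩
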